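/- **Setting.** Write $\widehat f(u)=\int_{\mathbb R}e^{-iux}f(x)\,dx$, extended to $L^2(\mathbb R)=L^2(\mathbb R;\mathbb C)$, with inner product $\langle f,g\rangle=\int f\,\overline g$. Let $m:\mathbb R\to[0,\infty)$ be measurable with $\int_{\mathbb R}\frac{m(u)}{u^2+1}\,du<\infty$, and assume that there are $K,K'\in(0,\infty)$ and $b<2$ with $$m(u)\le K|u|^{-b}\ \ (0<|u|\le 1),\qquad m(u)\le K'\ \ (|u|>1).$$ Let $T_m$ be the operator in $L^2(\mathbb R)$ with $\widehat{T_mf}=\sqrt m\,\widehat f$ and domain $\{f:\int m|\widehat f|^2<\infty\}$. Put $I_t=1_{[0,t]}$ for $t\ge0$ and $I_t=-1_{[t,0]}$ for $t<0$. Let $h_n(x)=(-1)^ne^{x^2/2}\frac{d^n}{dx^n}e^{-x^2/2}$ and $\widetilde h_k(x)=\pi^{-1/4}((k-1)!)^{-1/2}h_{k-1}(\sqrt2x)e^{-x^2/2}$, $k\ge1$. Let $\Omega$ be the space of real tempered distributions on $\mathbb R$ with its Borel $\sigma$-algebra (weak-star topology), and $P$ the white noise measure, i.e. the probability measure on $\Omega$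 with $E\,e^{i\langle\omega,s\rangle}=e^{-\|s\|_{L^2}^2/2}$ for all real Schwartz functions $s$. Let $f\mapsto Q_f$ be the complex linear isometry $L^2(\mathbb R)\to L^2(\Omega,P;\mathbb C)$ that extends $s\mapsto\langle\cdot,s\rangle$. For finitely supported $\alpha=(\alpha_1,\alpha_2,\dots)\in\ell=\mathbb N_0^{(\mathbb N)}$ put $H_\alpha=\prod_kh_{\alpha_k}(Q_{\widetilde h_k})$, $\alpha!=\prod_k\alpha_k!$, $(2\mathbb N)^{\alpha}=\prod_k(2k)^{\alpha_k}$, $z^\alpha=\prod_kz_k^{\alpha_k}$ for $z\in\mathbb C^{\mathbb N}$, and let $\epsilon^{(k)}\in\ell$ be the $k$-th unit sequence. The Kondratiev space $S_{-1}$ consists of the formal series $F=\sum_\alpha c_\alpha H_\alpha$ with $\|F\|_{-q}^2:=\sum_\alpha|c_\alpha|^2(2\mathbb N)^{-q\alpha}<\infty$ for some $q\in\mathbb N$. A random variable $F\in L^2(\Omega,P;\mathbb C)$ is identified with its Wiener--It\^o expansion, $c_\alpha=E(FH_\alpha)/\alpha!$. The Hermite transform is $\mathbf I(F)(z)=\sum_\alpha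 c_\alpha z^\alpha$, and $K_q(\delta)=\{z\in\mathbb C^{\mathbb N}:\sum_{\alpha\in\ell}|z^\alpha|^2(2\mathbb N)^{q\alpha}<\delta^2\}$. **Theorem.** All $I_t$ and all $\widetilde h_k$ lie in the domain of $T_m$, and $T_m\widetilde h_k$ has the continuous representative $(T_m\widetilde h_k)(t)=\frac1{2\pi}\int_{\mathbb R}e^{itu}\sqrt{m(u)}\,\widehat{\widetilde h_k}(u)\,du$. Let $$B_m(t)=Q_{T_mI_t},\qquad W_m(t)=\sum_{k\ge1}(T_m\widetilde h_k)(t)\,H_{\epsilon^{(k)}},\qquad W_m^*(t)=\sum_{k\ge1}\overline{(T_m\widetilde h_k)(t)}\,H_{\epsilon^{(k)}}.$$ Then $B_m$ is differentiable as an $S_{-1}$-valued process on $\mathbb R$ with derivative $W_m^*$: for all $t\in\mathbb R$ one has $B_m(t),W_m^*(t)\in S_{-1}$, and there is $q$ such that $\|h^{-1}(B_m(t+h)-B_m(t))-W_m^*(t)\|_{-q}\to0$ as $h\to0$. Moreover, for every $\delta>0$, the series of the Hermite transforms of $B_m(t)$ and $W_m^*(t)$ converge absolutely for $(t,z)\in\mathbb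 R\times K_4(\delta)$, $$\frac{d}{dt}\,\mathbf I(B_m(t))(z)=\mathbf I(W_m^*(t))(z)\qquad\text{for all }t\in\mathbb R,\ z\in K_4(\delta),$$ and this holds boundedly: there is a constant $C$ with $|\mathbf I(W_m^*(t))(z)|\le C$ and $|h^{-1}(\mathbf I(B_m(t+h))(z)-\mathbf I(B_m(t))(z))|\le C$ for all $t\in\mathbb R$, $h\ne0$ and $z\in K_4(\delta)$. If $m$ is even (almost everywhere), then all of this holds with the $m$-white noise $W_m$ in place of $W_m^*$, that is, $\frac{dB_m(t)}{dt}=W_m(t)$. -/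

import Mathlib

open MeasureTheory Filter Topology
open scoped SchwartzMap FourierTransform ENNReal Nat ComplexConjugate

noncomputable section

namespace MWhiteNoise

/-! ### Hermite functions -/

theorem pow_mul_gaussian_le (n : ℕ) (x : ℝ) :
    |x| ^ n * Real.exp (-(x ^ 2 / 2)) ≤ 1 + 2 ^ n * n ! := by
  have h1 : |x| ^ n ≤ 1 + x ^ (2 * n) := by
    have : x ^ (2 * n) = (|x| ^ n) ^ 2 := by rw [pow_mul, ← sq_abs, ← pow_mul, ← pow_mul, mul_comm]
    rw [this]
    nlinarith [sq_nonneg (|x| ^ n - 1 / 2), sq_nonneg (|x| ^ n)]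
  have h2 := Real.pow_div_factorial_le_exp (x ^ 2 / 2) (by positivity) n
  have h3 : x ^ (2 * n) ≤ 2 ^ n * n ! * Real.exp (x ^ 2 / 2) := by
    rw [div_le_iff₀ (by positivity), div_pow, div_le_iff₀ (by positivity), ← pow_mul] at h2
    linarith
  have h4 : Real.exp (-(x ^ 2 / 2)) ≤ 1 := Real.exp_le_one_iff.2 (by nlinarith [sq_nonneg x])
  have h5 : Real.exp (x ^ 2 / 2) * Real.exp (-(x ^ 2 / 2)) = 1 := by
    rw [← Real.exp_add]; simp
  have h6 := Real.exp_pos (-(x ^ 2 / 2))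
  calc |x| ^ n * Real.exp (-(x ^ 2 / 2))
      ≤ (1 + x ^ (2 * n)) * Real.exp (-(x ^ 2 / 2)) := by gcongr
    _ ≤ (1 + 2 ^ n * n ! * Real.exp (x ^ 2 / 2)) * Real.exp (-(x ^ 2 / 2)) := by gcongr
    _ = Real.exp (-(x ^ 2 / 2)) + 2 ^ n * n ! *
          (Real.exp (x ^ 2 / 2) * Real.exp (-(x ^ 2 / 2))) := by ring
    _ ≤ _ := by rw [h5]; linarith

/-- The Gaussian `x ↦ exp (-x² / 2)` as a real Schwartz function. -/
def gaussianSchwartz : 𝓢(ℝ, ℝ) where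
  toFun x := Real.exp (-(x ^ 2 / 2))
  smooth' := by fun_prop
  decay' k n := by
    refine ⟨∑ i ∈ Finset.range ((Polynomial.hermite n).natDegree + 1),
      |((Polynomial.hermite n).coeff i : ℝ)| * (1 + 2 ^ (k + i) * (k + i)!), fun x => ?_⟩
    rw [norm_iteratedFDeriv_eq_norm_iteratedDeriv, iteratedDeriv_eq_iterate,
      Polynomial.deriv_gaussian_eq_hermite_mul_gaussian, norm_mul, norm_mul, norm_pow, norm_neg,
      norm_one, one_pow, one_mul, Polynomial.aeval_eq_sum_range, Real.norm_eq_abs x,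
      Real.norm_eq_abs (Real.exp _), Real.abs_exp]
    calc |x| ^ k * (‖∑ i ∈ Finset.range ((Polynomial.hermite n).natDegree + 1),
            (Polynomial.hermite n).coeff i • x ^ i‖ * Real.exp (-(x ^ 2 / 2)))
        ≤ |x| ^ k * ((∑ i ∈ Finset.range ((Polynomial.hermite n).natDegree + 1),
            |((Polynomial.hermite n).coeff i : ℝ)| * |x| ^ i) * Real.exp (-(x ^ 2 / 2))) := by
          gcongr
          refine (norm_sum_le _ _).trans (le_of_eq (Finset.sum_congr rfl fun i _ => ?_))
          rw [zsmul_eq_mul, norm_mul, norm_pow, Real.norm_eq_abs, Real.norm_eq_abs]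
      _ = ∑ i ∈ Finset.range ((Polynomial.hermite n).natDegree + 1),
            |((Polynomial.hermite n).coeff i : ℝ)| *
              (|x| ^ (k + i) * Real.exp (-(x ^ 2 / 2))) := by
          rw [Finset.sum_mul, Finset.mul_sum]
          exact Finset.sum_congr rfl fun i _ => by rw [pow_add]; ring
      _ ≤ _ := by
          gcongr with i _
          exact pow_mul_gaussian_le _ _

/-- The polynomial factor `h_k (√2 x) / (π^{1/4} √(k!))` of the Hermite function, where
`h_k` is the probabilists' Hermite polynomial. -/
def hermiteFactor (k : ℕ) (x : ℝ) : ℝ :=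
  Polynomial.aeval (Real.sqrt 2 * x) (Polynomial.hermite k) /
    (Real.pi ^ (1 / 4 : ℝ) * Real.sqrt (k ! : ℝ))

theorem hermiteFactor_hasTemperateGrowth (k : ℕ) : (hermiteFactor k).HasTemperateGrowth := by
  have : hermiteFactor k = fun x => ∑ i ∈ Finset.range ((Polynomial.hermite k).natDegree + 1),
      (((Polynomial.hermite k).coeff i : ℝ) * Real.sqrt 2 ^ i /
        (Real.pi ^ (1 / 4 : ℝ) * Real.sqrt (k ! : ℝ))) * x ^ i := by
    funext x
    rw [hermiteFactor, Polynomial.aeval_eq_sum_range, Finset.sum_div]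
    refine Finset.sum_congr rfl fun i _ => ?_
    rw [zsmul_eq_mul, mul_pow]; ring
  rw [this]
  fun_prop

/-- The Hermite functions, numbered from `0`: `hermiteFun k` is
`h̃_{k+1}(x) = h_k(√2 x) e^{-x²/2} / (π^{1/4} √(k!))`. -/
def hermiteFun (k : ℕ) : 𝓢(ℝ, ℝ) :=
  SchwartzMap.smulLeftCLM ℝ (hermiteFactor k) gaussianSchwartz

theorem hermiteFun_apply (k : ℕ) (x : ℝ) :
    hermiteFun k x =
      Polynomial.aeval (Real.sqrt 2 * x) (Polynomial.hermite k) * Real.exp (-(x ^ 2 / 2)) /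
        (Real.pi ^ (1 / 4 : ℝ) * Real.sqrt (k ! : ℝ)) := by
  rw [hermiteFun, SchwartzMap.smulLeftCLM_apply_apply (hermiteFactor_hasTemperateGrowth k)]
  change hermiteFactor k x * Real.exp (-(x ^ 2 / 2)) = _
  rw [hermiteFactor]; ring

/-- The Hermite functions regarded as complex valued Schwartz functions. -/
def hermiteFunC (k : ℕ) : 𝓢(ℝ, ℂ) := SchwartzMap.postcompCLM Complex.ofRealCLM (hermiteFun k)

/-! ### The operator `T_m` -/

/-- `L²(ℝ; ℂ)`. -/
abbrev L2 : Type := Lp ℂ 2 (volume : Measure ℝ)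

/-- The multiplier `√m` in the frequency variable of Mathlib's Fourier transform: with
`f̂(u) = ∫ e^{-iux} f(x) dx` one has `f̂(2πξ) = 𝓕 f ξ`, so that multiplying `f̂` by `√m(u)`
is multiplying `𝓕 f` by `√m(2πξ)`. -/
def symbol (m : ℝ → ℝ) (ξ : ℝ) : ℂ := (Real.sqrt (m (2 * Real.pi * ξ)) : ℂ)

/-- The domain of `T_m`: those `f ∈ L²` for which `√m f̂ ∈ L²`. -/
def MemDom (m : ℝ → ℝ) (f : L2) : Prop :=
  MemLp (fun ξ => symbol m ξ * (𝓕 f : L2) ξ) 2 (volume : Measure ℝ)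

open Classical in
/-- The operator `T_m`, with `(T_m f)^ = √m f̂` for `f` in its domain (and the value `0`
outside of the domain). -/
def opT (m : ℝ → ℝ) (f : L2) : L2 :=
  if hf : MemDom m f then 𝓕⁻ (MemLp.toLp _ hf : L2) else 0

/-- The function `T_m f` for a Schwartz function `f`, given at every point by the inverse
Fourier integral of `√m f̂`. -/
def opTFun (m : ℝ → ℝ) (f : 𝓢(ℝ, ℂ)) : ℝ → ℂ :=
  𝓕⁻ (fun ξ : ℝ => symbol m ξ * (𝓕 f) ξ)

/-- `I_t`: the indicator function of `[0, t]` for `t ≥ 0`, minus the indicator function of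
`[t, 0]` for `t < 0`. -/
def indicatorI (t : ℝ) : L2 :=
  if 0 ≤ t then
    indicatorConstLp 2 (measurableSet_Icc : MeasurableSet (Set.Icc 0 t)) (by simp) (1 : ℂ)
  else
    -indicatorConstLp 2 (measurableSet_Icc : MeasurableSet (Set.Icc t 0)) (by simp) (1 : ℂ)

/-! ### The white noise space -/

/-- The space `Ω` of real tempered distributions, with the weak-star topology. -/
abbrev Omega : Type := WeakDual ℝ 𝓢(ℝ, ℝ)

instance : MeasurableSpace Omega := borel _
instance : BorelSpace Omega := ⟨rfl⟩

/-- `P` is the white noise probability measure on `Ω`: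
`E exp(i⟨ω, s⟩) = exp(-‖s‖² / 2)` for all real Schwartz functions `s`. -/
structure IsWhiteNoise (P : Measure Omega) : Prop where
  prob : IsProbabilityMeasure P
  charFunctional : ∀ s : 𝓢(ℝ, ℝ),
    ∫ ω, Complex.exp (Complex.I * ((ω s : ℝ) : ℂ)) ∂P =
      Complex.exp (-((∫ x, s x ^ 2 : ℝ) : ℂ) / 2)

theorem measurable_eval (s : 𝓢(ℝ, ℝ)) : Measurable (fun ω : Omega => ω s) :=
  (WeakDual.eval_continuous s).measurable

theorem IsWhiteNoise.map_eq {P : Measure Omega} (hP : IsWhiteNoise P) (s : 𝓢(ℝ, ℝ)) :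
    P.map (fun ω : Omega => ω s) =
      ProbabilityTheory.gaussianReal 0 (Real.toNNReal (∫ x, s x ^ 2)) := by
  have := hP.prob
  have : IsProbabilityMeasure (P.map (fun ω : Omega => ω s)) :=
    Measure.isProbabilityMeasure_map (measurable_eval s).aemeasurable
  refine Measure.ext_of_charFun ?_
  funext t
  rw [charFun_apply_real, ProbabilityTheory.charFun_gaussianReal,
    integral_map (measurable_eval s).aemeasurable (by fun_prop)]
  have h := hP.charFunctional (t • s)
  have h0 : 0 ≤ ∫ x, s x ^ 2 := integral_nonneg fun x => sq_nonneg _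
  have h1 : ∫ x, (t • s) x ^ 2 = t ^ 2 * ∫ x, s x ^ 2 := by
    rw [← integral_const_mul]
    congr 1; funext x; simp [mul_pow]
  rw [h1] at h
  convert h using 1
  · congr 1; funext ω; congr 1; simp; ring
  · congr 1
    simp [Real.coe_toNNReal _ h0]; ring

/-- The random variable `Q_s(ω) = ⟨ω, Re s⟩ + i ⟨ω, Im s⟩` for a complex Schwartz function. -/
def pairing (s : 𝓢(ℝ, ℂ)) (ω : Omega) : ℂ :=
  ((ω (SchwartzMap.postcompCLM Complex.reCLM s) : ℝ) : ℂ) +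
    Complex.I * ((ω (SchwartzMap.postcompCLM Complex.imCLM s) : ℝ) : ℂ)

theorem IsWhiteNoise.memLp_eval {P : Measure Omega} (hP : IsWhiteNoise P) (s : 𝓢(ℝ, ℝ)) :
    MemLp (fun ω : Omega => ω s) 2 P := by
  have h : MemLp (id : ℝ → ℝ) 2 (P.map (fun ω : Omega => ω s)) := by
    rw [hP.map_eq s]
    exact_mod_cast ProbabilityTheory.memLp_id_gaussianReal 2
  exact h.comp_of_map (measurable_eval s).aemeasurable

theorem IsWhiteNoise.integral_eval_sq {P : Measure Omega} (hP : IsWhiteNoise P) (s : 𝓢(ℝ, ℝ)) :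
    ∫ ω, (ω s : ℝ) ^ 2 ∂P = ∫ x, s x ^ 2 := by
  have h0 : 0 ≤ ∫ x, s x ^ 2 := integral_nonneg fun x => sq_nonneg _
  have h : ∫ ω, (ω s : ℝ) ^ 2 ∂P = ∫ y, y ^ 2 ∂(P.map (fun ω : Omega => ω s)) :=
    (integral_map (measurable_eval s).aemeasurable
      (f := fun y : ℝ => y ^ 2) (by fun_prop)).symm
  have hv := ProbabilityTheory.variance_id_gaussianReal (μ := 0)
    (v := Real.toNNReal (∫ x, s x ^ 2))
  rw [ProbabilityTheory.variance_of_integral_eq_zero aemeasurable_id (by simp)] at hv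
  rw [h, hP.map_eq s]
  simpa [h0] using hv

theorem IsWhiteNoise.memLp_pairing {P : Measure Omega} (hP : IsWhiteNoise P) (s : 𝓢(ℝ, ℂ)) :
    MemLp (pairing s) 2 P := by
  have h1 := (hP.memLp_eval (SchwartzMap.postcompCLM Complex.reCLM s)).ofReal (K := ℂ)
  have h2 := (hP.memLp_eval (SchwartzMap.postcompCLM Complex.imCLM s)).ofReal (K := ℂ)
  exact h1.add (h2.const_mul Complex.I)

/-- `s ↦ Q_s` on complex Schwartz functions, with values in the white noise space. -/
def schwartzQ {P : Measure Omega} (hP : IsWhiteNoise P) : 𝓢(ℝ, ℂ) →ₗ[ℂ] Lp ℂ 2 P where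
  toFun s := (hP.memLp_pairing s).toLp
  map_add' s r := by
    rw [← MemLp.toLp_add]
    refine MemLp.toLp_congr _ _ (Eventually.of_forall fun ω => ?_)
    simp only [pairing, map_add, Pi.add_apply]
    push_cast; ring
  map_smul' c s := by
    rw [RingHom.id_apply, ← MemLp.toLp_const_smul]
    refine MemLp.toLp_congr _ _ (Eventually.of_forall fun ω => ?_)
    have h1 : SchwartzMap.postcompCLM Complex.reCLM (c • s) =
        c.re • SchwartzMap.postcompCLM Complex.reCLM s -
          c.im • SchwartzMap.postcompCLM Complex.imCLM s := by
      ext x; simp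
    have h2 : SchwartzMap.postcompCLM Complex.imCLM (c • s) =
        c.re • SchwartzMap.postcompCLM Complex.imCLM s +
          c.im • SchwartzMap.postcompCLM Complex.reCLM s := by
      ext x; simp
    simp only [pairing, h1, h2, map_add, map_sub, map_smul, Pi.smul_apply, smul_eq_mul]
    apply Complex.ext <;> simp

theorem norm_toLp_sq {X : Type*} [MeasurableSpace X] {μ : Measure X} {f : X → ℂ}
    (hf : MemLp f 2 μ) : ‖hf.toLp‖ ^ 2 = ∫ x, ‖f x‖ ^ 2 ∂μ := by
  have h := inner_self_eq_norm_sq (𝕜 := ℂ) hf.toLp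
  rw [L2.inner_def, ← integral_re (L2.integrable_inner _ _)] at h
  rw [← h]
  refine integral_congr_ae ?_
  filter_upwards [hf.coeFn_toLp] with x hx
  rw [inner_self_eq_norm_sq (𝕜 := ℂ), hx]

/-- `s ↦ Q_s` is an isometry. -/
theorem norm_schwartzQ {P : Measure Omega} (hP : IsWhiteNoise P) (s : 𝓢(ℝ, ℂ)) :
    ‖schwartzQ hP s‖ = ‖SchwartzMap.toLpCLM ℂ ℂ 2 (volume : Measure ℝ) s‖ := by
  have key : ∀ w : ℂ, ‖w‖ ^ 2 = w.re ^ 2 + w.im ^ 2 := fun w => by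
    rw [Complex.sq_norm, Complex.normSq_apply]; ring
  rw [← sq_eq_sq₀ (norm_nonneg _) (norm_nonneg _)]
  have h1 : ‖schwartzQ hP s‖ ^ 2 = ∫ ω, ‖pairing s ω‖ ^ 2 ∂P :=
    norm_toLp_sq (hP.memLp_pairing s)
  have h2 : ‖SchwartzMap.toLpCLM ℂ ℂ 2 (volume : Measure ℝ) s‖ ^ 2 = ∫ x, ‖s x‖ ^ 2 := by
    have h := norm_toLp_sq (s.memLp 2 volume)
    rw [SchwartzMap.toLpCLM_apply]
    exact h
  have h3 := (hP.memLp_eval (SchwartzMap.postcompCLM Complex.reCLM s)).integrable_sq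
  have h4 := (hP.memLp_eval (SchwartzMap.postcompCLM Complex.imCLM s)).integrable_sq
  have h5 := ((SchwartzMap.postcompCLM Complex.reCLM s).memLp 2 volume).integrable_sq
  have h6 := ((SchwartzMap.postcompCLM Complex.imCLM s).memLp 2 volume).integrable_sq
  have h7 : ∀ ω, ‖pairing s ω‖ ^ 2 = ω (SchwartzMap.postcompCLM Complex.reCLM s) ^ 2 +
      ω (SchwartzMap.postcompCLM Complex.imCLM s) ^ 2 := fun ω => by
    rw [key]; simp [pairing]
  have h8 : ∀ x, ‖s x‖ ^ 2 = SchwartzMap.postcompCLM Complex.reCLM s x ^ 2 +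
      SchwartzMap.postcompCLM Complex.imCLM s x ^ 2 := fun x => by
    rw [key]; simp
  rw [h1, h2]
  simp_rw [h7, h8]
  rw [integral_add h3 h4, integral_add h5 h6, hP.integral_eval_sq, hP.integral_eval_sq]

/-- The isometry `f ↦ Q_f` from `L²(ℝ; ℂ)` to the white noise space `L²(Ω; ℂ)`: the continuous
extension of `s ↦ Q_s` from the dense subspace of Schwartz functions. -/
def Q {P : Measure Omega} (hP : IsWhiteNoise P) : L2 →L[ℂ] Lp ℂ 2 P :=
  (schwartzQ hP).extendOfNorm (SchwartzMap.toLpCLM ℂ ℂ 2 (volume : Measure ℝ)).toLinearMap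

theorem Q_toLp {P : Measure Omega} (hP : IsWhiteNoise P) (s : 𝓢(ℝ, ℂ)) :
    Q hP (s.toLp 2) = (hP.memLp_pairing s).toLp :=
  LinearMap.extendOfNorm_eq
    (e := (SchwartzMap.toLpCLM ℂ ℂ 2 (volume : Measure ℝ)).toLinearMap)
    (SchwartzMap.denseRange_toLpCLM (by simp))
    ⟨1, fun x => by rw [one_mul]; exact (norm_schwartzQ hP x).le⟩ s

/-! ### Chaos expansions and the Kondratiev space -/

/-- The index set `ℓ` of finitely supported sequences of natural numbers; sequences are numbered
from `0`, so that `k` here stands for the usual index `k + 1`. -/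
abbrev Idx : Type := ℕ →₀ ℕ

/-- `H_α(ω) = ∏ₖ h_{α_k}(Q_{h̃_k}(ω))`. -/
def chaosH (α : Idx) (ω : Omega) : ℝ :=
  α.prod fun k n => Polynomial.aeval (ω (hermiteFun k) : ℝ) (Polynomial.hermite n)

/-- `α! = ∏ₖ α_k!`. -/
def idxFactorial (α : Idx) : ℕ := α.prod fun _ n => n !

/-- `(2ℕ)^α = ∏ₖ (2k)^{α_k}` (with `k ≥ 1`). -/
def idxWeight (α : Idx) : ℝ := α.prod fun k n => (2 * ((k : ℝ) + 1)) ^ n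

/-- `z^α = ∏ₖ z_k^{α_k}`. -/
def idxMonomial (z : ℕ → ℂ) (α : Idx) : ℂ := α.prod fun k n => z k ^ n

/-- Formal expansions `∑_α c_α H_α`. -/
abbrev FormalChaos : Type := Idx → ℂ

/-- The Wiener-Itô coefficients `c_α = E(F H_α) / α!` of `F ∈ L²(Ω; ℂ)`, that is, those of
`F = ∑_α c_α H_α`. -/
def chaosExpansion {P : Measure Omega} (F : Lp ℂ 2 P) : FormalChaos := fun α =>
  (∫ ω, F ω * (chaosH α ω : ℂ) ∂P) / (idxFactorial α : ℂ)

/-- The squared norm `∑_α |c_α|² (2ℕ)^{-qα}`. -/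
def kondratievNormSq (q : ℕ) (F : FormalChaos) : ℝ≥0∞ :=
  ∑' α, ENNReal.ofReal (‖F α‖ ^ 2 / idxWeight α ^ q)

/-- Membership in the Kondratiev space `S_{-1}`. -/
def IsKondratiev (F : FormalChaos) : Prop := ∃ q : ℕ, kondratievNormSq q F < ∞

/-- The Hermite transform `I(F)(z) = ∑_α c_α z^α`. -/
def hermiteTransform (F : FormalChaos) (z : ℕ → ℂ) : ℂ := ∑' α, F α * idxMonomial z α

/-- The neighbourhoods `K_q(δ) = {z : ∑_α |z^α|² (2ℕ)^{qα} < δ²}`. -/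
def nbhdK (q : ℕ) (δ : ℝ) : Set (ℕ → ℂ) :=
  {z | ∑' α, ENNReal.ofReal (‖idxMonomial z α‖ ^ 2 * idxWeight α ^ q) < ENNReal.ofReal (δ ^ 2)}

/-- `X` is differentiable as an `S_{-1}`-valued process on the real line, with derivative `Y`:
both take values in `S_{-1}`, and the difference quotients of `X` at `t` converge to `Y t` in
one of the Hilbert spaces (weights `(2ℕ)^{-qα}`) whose union is `S_{-1}`. -/
def HasKondratievDeriv (X Y : ℝ → FormalChaos) : Prop :=
  (∀ t, IsKondratiev (X t)) ∧ (∀ t, IsKondratiev (Y t)) ∧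
    ∀ t, ∃ q : ℕ, Tendsto
      (fun h : ℝ => kondratievNormSq q (fun α => (X (t + h) α - X t α) / (h : ℂ) - Y t α))
      (𝓝[≠] 0) (𝓝 0)

/-- `d/dt I(X(t))(z) = I(Y(t))(z)` for all real `t`, pointwise boundedly for `z ∈ K_q(δ)`: the
series of the Hermite transforms converge on `K_q(δ)`, the derivative exists and has the stated
value at every point, and the derivative and the difference quotients are bounded on
`ℝ × K_q(δ)`. -/
def HasHermiteDerivBoundedly (q : ℕ) (δ : ℝ) (X Y : ℝ → FormalChaos) : Prop :=
  (∀ t, ∀ z ∈ nbhdK q δ,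
    Summable (fun α => X t α * idxMonomial z α) ∧
    Summable (fun α => Y t α * idxMonomial z α) ∧
    HasDerivAt (fun s => hermiteTransform (X s) z) (hermiteTransform (Y t) z) t) ∧
  ∃ C : ℝ, ∀ t, ∀ z ∈ nbhdK q δ,
    ‖hermiteTransform (Y t) z‖ ≤ C ∧
    ∀ h : ℝ, h ≠ 0 →
      ‖(hermiteTransform (X (t + h)) z - hermiteTransform (X t) z) / (h : ℂ)‖ ≤ C

/-! ### The `m`-Brownian motion and the `m`-white noise -/

/-- The `m`-Brownian motion `B_m(t) = Q_{T_m I_t}`. -/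
def mBrownian {P : Measure Omega} (hP : IsWhiteNoise P) (m : ℝ → ℝ) (t : ℝ) : Lp ℂ 2 P :=
  Q hP (opT m (indicatorI t))

/-- The formal series `∑ₖ c_k H_{ε^{(k)}}`. -/
def firstChaos (c : ℕ → ℂ) : FormalChaos := fun α =>
  ∑ k ∈ α.support, if α = Finsupp.single k 1 then c k else 0

/-- The `m`-white noise `W_m(t) = ∑ₖ (T_m h̃_k)(t) H_{ε^{(k)}}`. -/
def mWhiteNoise (m : ℝ → ℝ) (t : ℝ) : FormalChaos :=
  firstChaos fun k => opTFun m (hermiteFunC k) t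

/-- The series `∑ₖ (T_m h̃_k)(t)^* H_{ε^{(k)}}` with complex conjugate coefficients; it is
`W_m(t)` when `m` is even, since then the `T_m h̃_k` are real valued. -/
def mWhiteNoiseConj (m : ℝ → ℝ) (t : ℝ) : FormalChaos :=
  firstChaos fun k => conj (opTFun m (hermiteFunC k) t)

end MWhiteNoise

end

open MWhiteNoise

namespace MWhiteNoise

/-! ### Hermite functions: ladder relations and orthonormality -/

/-! Everything happens in the first chaos. `Q` is complex linear and the pairings of white noise
with orthogonal Schwartz functions are independent Gaussians, so `Q_f` has the coefficient `∫ f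
h̃_k` at the `k`-th unit sequence and zero elsewhere (`chaosExpansion_Q`). For `f = T_m I_t`,
symmetry of `T_m` and reality of `h̃_k` turn this into `∫_0^t conj (T_m h̃_k)`
(`integral_opT_indicatorI_mul`). This is where the conjugate in the derivative comes from. Since
`T_m h̃_k` is continuous, each coefficient is differentiable by the fundamental theorem of calculus,
with the coefficient of `W_m^*` as derivative.

Termwise differentiation needs a bound uniform in `t`. From `|√m f̂| ≤ m / (1 + u²) + (1 + u²)
|f̂|²` and Plancherel, `T_m f` is bounded by a constant plus `‖f‖² + ‖f'‖²` (`norm_opTFun_le`). The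
ladder relations bound `‖h̃_k'‖²` linearly in `k`, so the derivatives of the coefficients grow at
most linearly in `k` (`norm_opTFun_hermiteFunC_le`).

Linear growth is what the exponent 4 absorbs. In the Kondratiev norm the squared terms are dominated
by a multiple of `1 / k²`, and dominated convergence applies; on `K_4(δ)` the sum `∑ k |z_k|` is
bounded by a constant, which gives termwise differentiation of the Hermite transforms and the
uniform bounds. -/

theorem derivative_hermite_succ (n : ℕ) :
    Polynomial.derivative (Polynomial.hermite (n + 1)) =
      ((n : Polynomial ℤ) + 1) * Polynomial.hermite n := by
  induction n with
  | zero => simp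
  | succ n ih =>
    rw [Polynomial.hermite_succ (n + 1)]
    rw [Polynomial.derivative_sub, Polynomial.derivative_mul, ih]
    simp only [Polynomial.derivative_X, one_mul, Polynomial.derivative_mul,
      Polynomial.derivative_add, Polynomial.derivative_natCast, Polynomial.derivative_one]
    -- With `H` for `hermite`, the recursion identifies `(n + 1) (X H_n - H_n')` with `(n + 1)
    -- H_{n+1}`, which joins the single `H_{n+1}` from differentiating `X`.
    rw [Polynomial.hermite_succ n]
    push_cast
    ring

theorem hermiteConst_pos (n : ℕ) : 0 < Real.pi ^ (1 / 4 : ℝ) * Real.sqrt (n ! : ℝ) :=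
  mul_pos (Real.rpow_pos_of_pos Real.pi_pos _)
    (Real.sqrt_pos.2 (by exact_mod_cast Nat.factorial_pos n))

theorem sqrt_factorial_succ (n : ℕ) :
    Real.sqrt ((n + 1)! : ℝ) = Real.sqrt ((n : ℝ) + 1) * Real.sqrt (n ! : ℝ) := by
  rw [← Real.sqrt_mul (by positivity), Nat.factorial_succ]
  push_cast; rfl

theorem deriv_hermiteFun (n : ℕ) (x : ℝ) :
    deriv (hermiteFun n) x =
      (Real.sqrt 2 * Polynomial.aeval (Real.sqrt 2 * x)
          (Polynomial.derivative (Polynomial.hermite n)) -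
        x * Polynomial.aeval (Real.sqrt 2 * x) (Polynomial.hermite n)) *
        Real.exp (-(x ^ 2 / 2)) / (Real.pi ^ (1 / 4 : ℝ) * Real.sqrt (n ! : ℝ)) := by
  have h1 : HasDerivAt (fun x : ℝ => Polynomial.aeval (Real.sqrt 2 * x) (Polynomial.hermite n))
      (Polynomial.aeval (Real.sqrt 2 * x) (Polynomial.derivative (Polynomial.hermite n)) *
        (Real.sqrt 2 * 1)) x :=
    (Polynomial.hasDerivAt_aeval (Polynomial.hermite n) (Real.sqrt 2 * x)).comp x
      ((hasDerivAt_id x).const_mul _)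
  have h2 : HasDerivAt (fun x : ℝ => Real.exp (-(x ^ 2 / 2)))
      (Real.exp (-(x ^ 2 / 2)) * (-(((2 : ℕ) : ℝ) * x ^ (2 - 1) / 2))) x :=
    (((hasDerivAt_pow 2 x).div_const 2).neg).exp
  have h3 := (h1.mul h2).div_const (Real.pi ^ (1 / 4 : ℝ) * Real.sqrt (n ! : ℝ))
  have h4 : (hermiteFun n : ℝ → ℝ) = fun x =>
      (Polynomial.aeval (Real.sqrt 2 * x) (Polynomial.hermite n) * Real.exp (-(x ^ 2 / 2))) /
        (Real.pi ^ (1 / 4 : ℝ) * Real.sqrt (n ! : ℝ)) := funext (hermiteFun_apply n)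
  rw [h4]
  refine h3.deriv.trans ?_
  congr 1
  push_cast
  ring

/-- The creation relation `x h̃ - h̃' = √(2 (n + 1)) h̃₊`. -/
theorem hermiteFun_creation (n : ℕ) (x : ℝ) :
    x * hermiteFun n x - deriv (hermiteFun n) x =
      Real.sqrt 2 * Real.sqrt ((n : ℝ) + 1) * hermiteFun (n + 1) x := by
  rw [deriv_hermiteFun, hermiteFun_apply, hermiteFun_apply, Polynomial.hermite_succ,
    sqrt_factorial_succ]
  have h1 : Real.sqrt 2 * Real.sqrt 2 = 2 := Real.mul_self_sqrt (by norm_num)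
  have h2 := (hermiteConst_pos n).ne'
  have h3 : Real.sqrt ((n : ℝ) + 1) ≠ 0 := (Real.sqrt_pos.2 (by positivity)).ne'
  have h4 := left_ne_zero_of_mul h2
  have h5 := right_ne_zero_of_mul h2
  simp only [map_sub, map_mul, Polynomial.aeval_X]
  generalize Polynomial.aeval (Real.sqrt 2 * x) (Polynomial.hermite n) = p
  generalize Polynomial.aeval (Real.sqrt 2 * x)
    (Polynomial.derivative (Polynomial.hermite n)) = p'
  field_simp
  linear_combination (-x * p) * h1

/-- The annihilation relation `x h̃₊ + h̃₊' = √(2 (n + 1)) h̃`. -/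
theorem hermiteFun_annihilation (n : ℕ) (x : ℝ) :
    x * hermiteFun (n + 1) x + deriv (hermiteFun (n + 1)) x =
      Real.sqrt 2 * Real.sqrt ((n : ℝ) + 1) * hermiteFun n x := by
  rw [deriv_hermiteFun, hermiteFun_apply, hermiteFun_apply, derivative_hermite_succ,
    sqrt_factorial_succ]
  have h2 := (hermiteConst_pos n).ne'
  have h3 : Real.sqrt ((n : ℝ) + 1) ≠ 0 := (Real.sqrt_pos.2 (by positivity)).ne'
  have h6 : Real.sqrt ((n : ℝ) + 1) * Real.sqrt ((n : ℝ) + 1) = n + 1 :=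
    Real.mul_self_sqrt (by positivity)
  have h4 := left_ne_zero_of_mul h2
  have h5 := right_ne_zero_of_mul h2
  simp only [map_add, map_mul, map_natCast, map_one]
  generalize Polynomial.aeval (Real.sqrt 2 * x) (Polynomial.hermite n) = p
  generalize Polynomial.aeval (Real.sqrt 2 * x) (Polynomial.hermite (n + 1)) = p'
  field_simp
  linear_combination (-Real.sqrt 2 * p) * h6

theorem hermiteFun_zero_annihilation (x : ℝ) :
    x * hermiteFun 0 x + deriv (hermiteFun 0) x = 0 := by
  rw [deriv_hermiteFun, hermiteFun_apply]
  simp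
  ring

theorem integrable_schwartz_mul (f g : 𝓢(ℝ, ℝ)) : Integrable (fun x => f x * g x) :=
  (SchwartzMap.pairing (ContinuousLinearMap.mul ℝ ℝ) f g).integrable

theorem integrable_schwartz_mul_deriv (f g : 𝓢(ℝ, ℝ)) :
    Integrable (fun x => f x * deriv g x) :=
  (SchwartzMap.pairing (ContinuousLinearMap.mul ℝ ℝ) f (SchwartzMap.derivCLM ℝ ℝ g)).integrable

theorem integrable_schwartz_id_mul_mul (f g : 𝓢(ℝ, ℝ)) :
    Integrable (fun x => x * (f x * g x)) := by
  have h := (SchwartzMap.smulLeftCLM ℝ (fun x : ℝ => x)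
    (SchwartzMap.pairing (ContinuousLinearMap.mul ℝ ℝ) f g)).integrable (μ := volume)
  refine h.congr (Eventually.of_forall fun x => ?_)
  rw [SchwartzMap.smulLeftCLM_apply_apply (by fun_prop)]
  rfl

/-- The operators `x - d/dx` and `x + d/dx` are adjoint to each other. -/
theorem integral_creation_mul (f g : 𝓢(ℝ, ℝ)) :
    ∫ x, (x * f x - deriv f x) * g x = ∫ x, f x * (x * g x + deriv g x) := by
  have h1 := integrable_schwartz_id_mul_mul f g
  have h2 := integrable_schwartz_mul_deriv f g
  have h3 := integrable_schwartz_mul_deriv g f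
  have h4 : ∀ x, (x * f x - deriv f x) * g x = x * (f x * g x) - g x * deriv f x :=
    fun x => by ring
  have h5 : ∀ x, f x * (x * g x + deriv g x) = x * (f x * g x) + f x * deriv g x :=
    fun x => by ring
  simp_rw [h4, h5]
  rw [integral_sub h1 h3, integral_add h1 h2, SchwartzMap.integral_mul_deriv_eq_neg_deriv_mul f g]
  simp_rw [mul_comm (deriv f _)]
  ring

theorem integral_hermiteFun_zero_sq : ∫ x, hermiteFun 0 x * hermiteFun 0 x = 1 := by
  have h1 : ∀ x, hermiteFun 0 x * hermiteFun 0 x =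
      (Real.sqrt Real.pi)⁻¹ * Real.exp (-1 * x ^ 2) := fun x => by
    have h : Real.pi ^ (1 / 4 : ℝ) * Real.pi ^ (1 / 4 : ℝ) = Real.sqrt Real.pi := by
      rw [← Real.rpow_add Real.pi_pos, Real.sqrt_eq_rpow]; norm_num
    have he : Real.exp (-(x ^ 2 / 2)) * Real.exp (-(x ^ 2 / 2)) = Real.exp (-1 * x ^ 2) := by
      rw [← Real.exp_add]; congr 1; ring
    rw [hermiteFun_apply, ← h, ← he]
    have h0 : Real.pi ^ (1 / 4 : ℝ) ≠ 0 := (Real.rpow_pos_of_pos Real.pi_pos _).ne'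
    simp
    field_simp
  simp_rw [h1]
  rw [integral_const_mul, integral_gaussian, div_one]
  exact inv_mul_cancel₀ (Real.sqrt_pos.2 Real.pi_pos).ne'

/-- The creation operator producing `h̃₊` moves to the ground state as the annihilation operator,
which kills it. -/
theorem integral_hermiteFun_succ_mul_zero (n : ℕ) :
    ∫ x, hermiteFun (n + 1) x * hermiteFun 0 x = 0 := by
  have h := integral_creation_mul (hermiteFun n) (hermiteFun 0)
  simp_rw [hermiteFun_creation, hermiteFun_zero_annihilation, mul_zero, integral_zero,
    mul_assoc] at h
  rw [integral_const_mul, integral_const_mul] at h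
  have h3 : Real.sqrt ((n : ℝ) + 1) ≠ 0 := (Real.sqrt_pos.2 (by positivity)).ne'
  simpa [h3] using h

/-- The Hermite functions are orthonormal. -/
theorem integral_hermiteFun_mul (j k : ℕ) :
    ∫ x, hermiteFun j x * hermiteFun k x = if j = k then 1 else 0 := by
  induction j generalizing k with
  | zero =>
    cases k with
    | zero => simpa using integral_hermiteFun_zero_sq
    | succ k => simp_rw [mul_comm (hermiteFun 0 _), integral_hermiteFun_succ_mul_zero]; simp
  | succ j ih =>
    cases k with
    | zero => simpa using integral_hermiteFun_succ_mul_zero j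
    | succ k =>
      -- Adjointness gives `√(2(j+1)) ⟨h̃_{j+1}, h̃_{k+1}⟩ = √(2(k+1)) ⟨h̃_j, h̃_k⟩`. The factors
      -- agree when `j = k`; otherwise the right side vanishes by induction.
      have h := integral_creation_mul (hermiteFun j) (hermiteFun (k + 1))
      have h2 : Real.sqrt 2 ≠ 0 := (Real.sqrt_pos.2 (by norm_num)).ne'
      have h3 : Real.sqrt ((j : ℝ) + 1) ≠ 0 := (Real.sqrt_pos.2 (by positivity)).ne'
      simp_rw [hermiteFun_creation, hermiteFun_annihilation,
        mul_left_comm (hermiteFun j _) (Real.sqrt 2 * Real.sqrt ((k : ℝ) + 1)),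
        mul_assoc (Real.sqrt 2 * _)] at h
      rw [integral_const_mul, integral_const_mul, ih] at h
      rcases eq_or_ne j k with rfl | hjk
      · simpa [h2, h3] using h
      · simpa [h2, h3, hjk] using h

theorem integral_hermiteFun_sq (n : ℕ) : ∫ x, hermiteFun n x ^ 2 = 1 := by
  simpa [sq] using integral_hermiteFun_mul n n

theorem integrable_schwartz_sq (f : 𝓢(ℝ, ℝ)) : Integrable (fun x => f x ^ 2) := by
  simpa [sq] using integrable_schwartz_mul f f

/-- The parallelogram identity for `x h̃ + h̃'` and `x h̃ - h̃'` bounds `h̃'²` by half the sum of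
their squares, which the ladder relations express through the two neighbouring Hermite functions.
The linear growth in `n` is the source of all later growth bounds. -/
theorem integral_deriv_hermiteFun_sq_le (n : ℕ) :
    ∫ x, deriv (hermiteFun n) x ^ 2 ≤ 2 * n + 1 := by
  have hd : Integrable (fun x => deriv (hermiteFun n) x ^ 2) :=
    integrable_schwartz_sq (SchwartzMap.derivCLM ℝ ℝ (hermiteFun n))
  have hs : ∀ j : ℕ, Real.sqrt ((j : ℝ) + 1) ^ 2 = j + 1 := fun j => Real.sq_sqrt (by positivity)
  have h2 : Real.sqrt 2 ^ 2 = 2 := Real.sq_sqrt (by norm_num)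
  cases n with
  | zero =>
    calc ∫ x, deriv (hermiteFun 0) x ^ 2 ≤ ∫ x, 1 / 2 * hermiteFun 1 x ^ 2 := by
          refine integral_mono hd ((integrable_schwartz_sq _).const_mul _) fun x => ?_
          have e1 := hermiteFun_creation 0 x
          have e2 := hermiteFun_zero_annihilation x
          have e3 : deriv (hermiteFun 0) x = -(1 / 2) * (Real.sqrt 2 * hermiteFun 1 x) := by
            simp at e1
            linarith
          simp only [e3, mul_pow, h2]
          linarith
      _ ≤ _ := by rw [integral_const_mul, integral_hermiteFun_sq]; norm_num
  | succ n =>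
    calc ∫ x, deriv (hermiteFun (n + 1)) x ^ 2
        ≤ ∫ x, ((n + 1 : ℝ) * hermiteFun n x ^ 2 +
            (n + 2 : ℝ) * hermiteFun (n + 2) x ^ 2) := by
          refine integral_mono hd (((integrable_schwartz_sq _).const_mul _).add
            ((integrable_schwartz_sq _).const_mul _)) fun x => ?_
          have e1 := hermiteFun_creation (n + 1) x
          have e2 := hermiteFun_annihilation n x
          have e4 := hs (n + 1)
          have e5 := congrArg (· ^ 2) e1
          have e6 := congrArg (· ^ 2) e2
          simp only [mul_pow, h2, e4, hs n] at e5 e6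
          push_cast at e5
          nlinarith [sq_nonneg (x * hermiteFun (n + 1) x)]
      _ ≤ _ := by
          rw [integral_add ((integrable_schwartz_sq _).const_mul _)
            ((integrable_schwartz_sq _).const_mul _), integral_const_mul, integral_const_mul,
            integral_hermiteFun_sq, integral_hermiteFun_sq]
          push_cast; linarith

end MWhiteNoise

namespace MWhiteNoise

/-! ### Gaussian moments and independence -/

/-- Orthonormality of the Hermite functions, transported by `x = √2 y`: the two factors `e^{-y²/2}`
multiply to the Gaussian weight `e^{-x²/2}`. -/
theorem integral_hermite_mul_hermite_gaussianReal (j k : ℕ) :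
    ∫ x, Polynomial.aeval x (Polynomial.hermite j) * Polynomial.aeval x (Polynomial.hermite k)
      ∂(ProbabilityTheory.gaussianReal 0 1) = if j = k then (j ! : ℝ) else 0 := by
  rw [ProbabilityTheory.integral_gaussianReal_eq_integral_smul one_ne_zero]
  set g : ℝ → ℝ := fun x => Polynomial.aeval x (Polynomial.hermite j) *
    Polynomial.aeval x (Polynomial.hermite k) * Real.exp (-(x ^ 2 / 2)) with hg
  have h1 : ∀ x, ProbabilityTheory.gaussianPDFReal 0 1 x •
      (Polynomial.aeval x (Polynomial.hermite j) * Polynomial.aeval x (Polynomial.hermite k)) =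
        (Real.sqrt (2 * Real.pi))⁻¹ * g x := fun x => by
    have : Real.exp (-(x - 0) ^ 2 / (2 * ((1 : NNReal) : ℝ))) = Real.exp (-(x ^ 2 / 2)) := by
      congr 1; simp; ring
    rw [ProbabilityTheory.gaussianPDFReal, this, hg, smul_eq_mul]
    simp only [NNReal.coe_one, mul_one]
    ring
  simp_rw [h1]
  rw [integral_const_mul]
  have hpi : Real.pi ^ (1 / 4 : ℝ) * Real.pi ^ (1 / 4 : ℝ) = Real.sqrt Real.pi := by
    rw [← Real.rpow_add Real.pi_pos, Real.sqrt_eq_rpow]; norm_num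
  have h2 : ∀ y, hermiteFun j y * hermiteFun k y =
      (Real.sqrt Real.pi * (Real.sqrt (j ! : ℝ) * Real.sqrt (k ! : ℝ)))⁻¹ *
        g (Real.sqrt 2 * y) := fun y => by
    have he : Real.exp (-((Real.sqrt 2 * y) ^ 2 / 2)) =
        Real.exp (-(y ^ 2 / 2)) * Real.exp (-(y ^ 2 / 2)) := by
      rw [← Real.exp_add, mul_pow, Real.sq_sqrt (by norm_num)]; congr 1; ring
    rw [hermiteFun_apply, hermiteFun_apply, hg, ← hpi]
    simp only [he]
    rw [div_mul_div_comm, inv_mul_eq_div]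
    congr 1 <;> ring
  have h3 := integral_hermiteFun_mul j k
  simp_rw [h2] at h3
  rw [integral_const_mul, Measure.integral_comp_mul_left, abs_of_pos (by positivity),
    smul_eq_mul] at h3
  have hj : 0 < Real.sqrt (j ! : ℝ) := Real.sqrt_pos.2 (by exact_mod_cast Nat.factorial_pos j)
  have hk : 0 < Real.sqrt (k ! : ℝ) := Real.sqrt_pos.2 (by exact_mod_cast Nat.factorial_pos k)
  have hp : 0 < Real.sqrt Real.pi := Real.sqrt_pos.2 Real.pi_pos
  have h4 : (Real.sqrt (2 * Real.pi))⁻¹ * ∫ x, g x =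
      Real.sqrt (j ! : ℝ) * Real.sqrt (k ! : ℝ) * if j = k then (1 : ℝ) else 0 := by
    rw [← h3, Real.sqrt_mul (by norm_num)]
    field_simp
  rw [h4]
  split_ifs with hjk
  · subst hjk
    rw [mul_one, Real.mul_self_sqrt (by positivity)]
  · simp

theorem integral_hermite_gaussianReal {n : ℕ} (hn : n ≠ 0) :
    ∫ x, Polynomial.aeval x (Polynomial.hermite n) ∂(ProbabilityTheory.gaussianReal 0 1) =
      (0 : ℝ) := by
  simpa [hn] using integral_hermite_mul_hermite_gaussianReal n 0

theorem integral_id_mul_hermite_gaussianReal (n : ℕ) :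
    ∫ x, x * Polynomial.aeval x (Polynomial.hermite n) ∂(ProbabilityTheory.gaussianReal 0 1) =
      if n = 1 then (1 : ℝ) else 0 := by
  simpa [eq_comm] using integral_hermite_mul_hermite_gaussianReal 1 n

/-- Asking for all finite exponents at once makes the class closed under products, by Hölder with
exponent `2p` on each factor. This covers the products of polynomials in Gaussians that form `H_α`.
-/
theorem memLp_mul_of_forall {X : Type*} [MeasurableSpace X] {μ : Measure X} {f g : X → ℝ}
    (hf : ∀ p : NNReal, MemLp f p μ) (hg : ∀ p : NNReal, MemLp g p μ) (p : NNReal) :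
    MemLp (fun x => f x * g x) p μ := by
  have : ENNReal.HolderTriple ((2 * p : NNReal) : ℝ≥0∞) ((2 * p : NNReal) : ℝ≥0∞) p := ⟨by
    rw [ENNReal.coe_mul, ENNReal.mul_inv (by simp) (by simp), ← add_mul]
    simp [ENNReal.inv_two_add_inv_two]⟩
  exact (hg (2 * p)).mul (hf (2 * p))

theorem memLp_aeval_of_forall {X : Type*} [MeasurableSpace X] {μ : Measure X}
    [IsFiniteMeasure μ] {f : X → ℝ} (hf : ∀ p : NNReal, MemLp f p μ) (P : Polynomial ℤ)
    (p : NNReal) : MemLp (fun x => Polynomial.aeval (f x) P) p μ := by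
  have hpow : ∀ (n : ℕ) (p : NNReal), MemLp (fun x => f x ^ n) p μ := by
    intro n
    induction n with
    | zero => intro p; simpa using memLp_const (1 : ℝ)
    | succ n ih =>
      intro p
      simp_rw [pow_succ]
      exact memLp_mul_of_forall ih hf p
  simp_rw [Polynomial.aeval_eq_sum_range, zsmul_eq_mul]
  exact memLp_finsetSum _ fun i _ => (hpow i p).const_mul _

theorem IsWhiteNoise.memLp_eval_of_ne_top {P : Measure Omega} (hP : IsWhiteNoise P)
    (s : 𝓢(ℝ, ℝ)) (p : NNReal) : MemLp (fun ω : Omega => ω s) p P := by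
  have h : MemLp (id : ℝ → ℝ) p (P.map (fun ω : Omega => ω s)) := by
    rw [hP.map_eq s]
    exact ProbabilityTheory.memLp_id_gaussianReal p
  exact h.comp_of_map (measurable_eval s).aemeasurable

theorem IsWhiteNoise.memLp_chaosH {P : Measure Omega} (hP : IsWhiteNoise P) (α : Idx)
    (p : NNReal) : MemLp (chaosH α) p P := by
  have := hP.prob
  have key : ∀ (S : Finset ℕ) (p : NNReal), MemLp (fun ω : Omega =>
      ∏ k ∈ S, Polynomial.aeval (ω (hermiteFun k) : ℝ) (Polynomial.hermite (α k))) p P := by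
    intro S
    induction S using Finset.induction_on with
    | empty => intro p; simpa using memLp_const (1 : ℝ)
    | insert a S ha ih =>
      intro p
      simp_rw [Finset.prod_insert ha]
      exact memLp_mul_of_forall
        (memLp_aeval_of_forall (hP.memLp_eval_of_ne_top _) _) ih p
  exact key α.support p

/-- Pairings of white noise with orthogonal Schwartz functions are independent. -/
theorem IsWhiteNoise.iIndepFun_eval {P : Measure Omega} (hP : IsWhiteNoise P) {ι : Type*}
    [Fintype ι] {s : ι → 𝓢(ℝ, ℝ)} (hs : ∀ i j, i ≠ j → ∫ x, s i x * s j x = 0) :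
    ProbabilityTheory.iIndepFun (fun i (ω : Omega) => (ω (s i) : ℝ)) P := by
  classical
  have := hP.prob
  rw [ProbabilityTheory.iIndepFun_iff_charFun_pi fun i => (measurable_eval (s i)).aemeasurable]
  intro t
  have hmeas : Measurable fun ω : Omega => WithLp.toLp 2 fun i => (ω (s i) : ℝ) :=
    (WithLp.measurable_toLp 2 _).comp (measurable_pi_lambda _ fun i => measurable_eval (s i))
  have key : ∀ r : 𝓢(ℝ, ℝ), ∀ u : ℝ,
      charFun (P.map fun ω : Omega => (ω r : ℝ)) u =
        Complex.exp (-((u ^ 2 * ∫ x, r x ^ 2 : ℝ) : ℂ) / 2) := by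
    intro r u
    rw [charFun_apply_real, integral_map (measurable_eval r).aemeasurable (by fun_prop)]
    have h := hP.charFunctional (u • r)
    have h1 : ∫ x, (u • r) x ^ 2 = u ^ 2 * ∫ x, r x ^ 2 := by
      rw [← integral_const_mul]
      congr 1; funext x; simp [mul_pow]
    rw [h1] at h
    rw [← h]
    congr 1; funext ω; congr 1; simp; ring
  simp_rw [key]
  rw [← Complex.exp_sum, charFun_apply, integral_map hmeas.aemeasurable (by fun_prop)]
  -- The joint characteristic function at `t` is the characteristic functional at `∑ t_i s_i`;
  -- orthogonality removes the cross terms of the squared norm, so the exponential factorises.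
  have h := hP.charFunctional (∑ i, t i • s i)
  have h2 : ∫ x, (∑ i, t i • s i) x ^ 2 = ∑ i, t i ^ 2 * ∫ x, s i x ^ 2 := by
    have e1 : ∀ x, (∑ i, t i • s i) x ^ 2 = ∑ i, ∑ j, (t i * t j) * (s i x * s j x) := by
      intro x
      rw [sq, sum_apply, Finset.sum_mul_sum]
      refine Finset.sum_congr rfl fun i _ => Finset.sum_congr rfl fun j _ => ?_
      simp only [smul_apply, smul_eq_mul]; ring
    simp_rw [e1]
    rw [integral_finsetSum _ fun i _ => integrable_finsetSum _ fun j _ =>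
      (integrable_schwartz_mul _ _).const_mul _]
    refine Finset.sum_congr rfl fun i _ => ?_
    rw [integral_finsetSum _ fun j _ => (integrable_schwartz_mul _ _).const_mul _]
    rw [Finset.sum_eq_single i]
    · rw [integral_const_mul]; simp_rw [sq]
    · intro j _ hj
      rw [integral_const_mul, hs i j hj.symm, mul_zero]
    · simp
  rw [h2] at h
  convert h using 1
  · congr 1; funext ω; congr 1
    rw [mul_comm]
    congr 2
    simp [PiLp.inner_apply, map_sum]
  · congr 1
    push_cast
    rw [← Finset.sum_neg_distrib, Finset.sum_div]

theorem IsWhiteNoise.map_hermiteFun {P : Measure Omega} (hP : IsWhiteNoise P) (k : ℕ) :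
    P.map (fun ω : Omega => ω (hermiteFun k)) = ProbabilityTheory.gaussianReal 0 1 := by
  rw [hP.map_eq, integral_hermiteFun_sq]; simp

/-! ### Wiener-Itô coefficients of `Q_f`. -/

theorem firstChaos_single (c : ℕ → ℂ) (k : ℕ) : firstChaos c (Finsupp.single k 1) = c k := by
  simp [firstChaos]

theorem firstChaos_of_notMem_range {c : ℕ → ℂ} {α : Idx}
    (hα : α ∉ Set.range fun k => Finsupp.single k 1) : firstChaos c α = 0 :=
  Finset.sum_eq_zero fun k _ => if_neg fun h => hα ⟨k, h.symm⟩

/-- `E(⟨ω, s⟩ H_α)` vanishes if `s` is orthogonal to the Hermite functions occurring in `H_α`. -/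
theorem IsWhiteNoise.integral_eval_mul_chaosH_of_orthogonal {P : Measure Omega}
    (hP : IsWhiteNoise P) (α : Idx) (r : 𝓢(ℝ, ℝ))
    (hr : ∀ k ∈ α.support, ∫ x, r x * hermiteFun k x = 0) :
    ∫ ω, (ω r : ℝ) * chaosH α ω ∂P = 0 := by
  have := hP.prob
  -- Adjoining `r` as the index `none` keeps the family orthogonal; the expectation then factorises
  -- and contains the factor `E⟨ω, r⟩ = 0`.
  let s : Option α.support → 𝓢(ℝ, ℝ) := fun o => o.elim r fun k => hermiteFun k
  have hs : ∀ i j, i ≠ j → ∫ x, s i x * s j x = 0 := by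
    rintro (_ | i) (_ | j) hij
    · exact absurd rfl hij
    · exact hr j j.2
    · simp_rw [s, mul_comm]; exact hr i i.2
    · refine (integral_hermiteFun_mul i j).trans (if_neg fun h => hij ?_)
      rw [Subtype.ext h]
  let f : Option α.support → ℝ → ℝ := fun o x =>
    o.elim x fun k => Polynomial.aeval x (Polynomial.hermite (α k))
  have hf : ∀ o, Measurable (f o) := by
    rintro (_ | k)
    · exact measurable_id
    · exact (Polynomial.continuous_aeval _).measurable
  have h := (hP.iIndepFun_eval hs).integral_prod_comp (f := f)
    (fun i => (measurable_eval (s i)).aemeasurable) (fun i => (hf i).aestronglyMeasurable)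
  have h0 : ∫ ω : Omega, (ω r : ℝ) ∂P = 0 := by
    have : ∫ ω : Omega, (ω r : ℝ) ∂P = ∫ y, y ∂(P.map fun ω : Omega => (ω r : ℝ)) :=
      (integral_map (measurable_eval r).aemeasurable (f := fun y : ℝ => y) (by fun_prop)).symm
    rw [this, hP.map_eq]; simp
  have h1 : ∫ ω : Omega, (f none ∘ fun ω : Omega => (ω (s none) : ℝ)) ω ∂P = 0 := h0
  replace h := h.trans (Finset.prod_eq_zero (Finset.mem_univ none) h1)
  rw [← h]
  congr 1
  funext ω
  rw [Fintype.prod_option, Pi.mul_apply, Finset.prod_apply]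
  congr 1
  exact (Finset.prod_coe_sort α.support
    fun k => Polynomial.aeval (ω (hermiteFun k) : ℝ) (Polynomial.hermite (α k))).symm

/-- The extra Gaussian is absorbed into slot `j`, and independence splits the expectation. Slots `k
≠ j` of the support contribute `E h_{α_k} = 0` because `α_k ≠ 0`, and slot `j` contributes `1`
exactly when `α_j = 1`. Hence only the unit sequence at `j` survives. -/
theorem IsWhiteNoise.integral_hermiteFun_mul_chaosH {P : Measure Omega}
    (hP : IsWhiteNoise P) (α : Idx) {j : ℕ} (hj : j ∈ α.support) :
    ∫ ω, (ω (hermiteFun j) : ℝ) * chaosH α ω ∂P =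
      if α = Finsupp.single j 1 then 1 else 0 := by
  classical
  have := hP.prob
  have hs : ∀ i k : α.support, i ≠ k → ∫ x, hermiteFun i x * hermiteFun k x = 0 := by
    intro i k hik
    exact (integral_hermiteFun_mul i k).trans (if_neg fun h => hik (Subtype.ext h))
  let f : α.support → ℝ → ℝ := fun k x =>
    (if (k : ℕ) = j then x else 1) * Polynomial.aeval x (Polynomial.hermite (α k))
  have hf : ∀ o, Measurable (f o) := by
    intro k
    refine Measurable.mul ?_ (Polynomial.continuous_aeval _).measurable
    split_ifs <;> fun_prop
  have h := (hP.iIndepFun_eval hs).integral_prod_comp (f := f)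
    (fun i => (measurable_eval (hermiteFun i)).aemeasurable)
    (fun i => (hf i).aestronglyMeasurable)
  have hfac : ∀ k : α.support,
      ∫ ω : Omega, (f k ∘ fun ω : Omega => (ω (hermiteFun k) : ℝ)) ω ∂P =
        if (k : ℕ) = j then (if α k = 1 then 1 else 0) else 0 := by
    intro k
    have e : ∫ ω : Omega, (f k ∘ fun ω : Omega => (ω (hermiteFun k) : ℝ)) ω ∂P =
        ∫ y, f k y ∂(P.map fun ω : Omega => (ω (hermiteFun k) : ℝ)) :=
      (integral_map (measurable_eval _).aemeasurable (hf k).aestronglyMeasurable).symm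
    rw [e, hP.map_hermiteFun]
    by_cases hk : (k : ℕ) = j
    · simp only [f, hk, if_true]
      exact integral_id_mul_hermite_gaussianReal _
    · simp only [f, hk, if_false, one_mul]
      exact integral_hermite_gaussianReal (Finsupp.mem_support_iff.1 k.2)
  have hL : ∫ ω, (ω (hermiteFun j) : ℝ) * chaosH α ω ∂P =
      ∫ ω, (∏ k, f k ∘ fun ω : Omega => (ω (hermiteFun k) : ℝ)) ω ∂P := by
    congr 1
    funext ω
    have e1 : ∏ k : α.support, (if (k : ℕ) = j then (ω (hermiteFun k) : ℝ) else 1) =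
        ω (hermiteFun j) := by
      rw [Finset.prod_coe_sort α.support
        fun k => if k = j then (ω (hermiteFun k) : ℝ) else 1, Finset.prod_ite_eq' , if_pos hj]
    rw [Finset.prod_apply]
    simp only [f, Function.comp]
    rw [Finset.prod_mul_distrib, e1]
    congr 1
    exact (Finset.prod_coe_sort α.support
      fun k => Polynomial.aeval (ω (hermiteFun k) : ℝ) (Polynomial.hermite (α k))).symm
  rw [hL, h]
  simp_rw [hfac]
  rw [Finset.prod_coe_sort α.support
    fun k => if k = j then (if α k = 1 then (1 : ℝ) else 0) else 0]
  split_ifs with hα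
  · rw [hα]; simp
  · by_cases h1 : α j = 1
    · have : ∃ k ∈ α.support, k ≠ j := by
        by_contra! hc
        refine hα (Finsupp.ext fun k => ?_)
        by_cases hk : k = j
        · simp [hk, h1]
        · rw [Finsupp.single_eq_of_ne hk]
          by_contra h0
          exact hk (hc k (Finsupp.mem_support_iff.2 h0))
      obtain ⟨k, hk, hkj⟩ := this
      exact Finset.prod_eq_zero hk (if_neg hkj)
    · exact Finset.prod_eq_zero hj (by simp [h1])

theorem integrable_eval_mul_chaosH {P : Measure Omega} (hP : IsWhiteNoise P) (s : 𝓢(ℝ, ℝ))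
    (α : Idx) : Integrable (fun ω : Omega => (ω s : ℝ) * chaosH α ω) P :=
  memLp_one_iff_integrable.1 (by
    simpa using memLp_mul_of_forall (hP.memLp_eval_of_ne_top s) (hP.memLp_chaosH α) 1)

/-- The first order chaos coefficients of `⟨ω, s⟩` are the Hermite coefficients of `s`. -/
theorem IsWhiteNoise.integral_eval_mul_chaosH {P : Measure Omega} (hP : IsWhiteNoise P)
    (s : 𝓢(ℝ, ℝ)) (α : Idx) :
    ((∫ ω, (ω s : ℝ) * chaosH α ω ∂P : ℝ) : ℂ) =
      firstChaos (fun k => ((∫ x, s x * hermiteFun k x : ℝ) : ℂ)) α := by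
  classical
  set a : ℕ → ℝ := fun k => ∫ x, s x * hermiteFun k x with ha
  -- Only the finitely many Hermite functions occurring in `H_α` are projected out, so completeness
  -- of the Hermite system plays no role.
  set r : 𝓢(ℝ, ℝ) := s - ∑ k ∈ α.support, a k • hermiteFun k with hr
  have horth : ∀ k ∈ α.support, ∫ x, r x * hermiteFun k x = 0 := by
    intro k hk
    have e : ∀ x, r x * hermiteFun k x = s x * hermiteFun k x -
        ∑ j ∈ α.support, a j * (hermiteFun j x * hermiteFun k x) := by
      intro x
      simp only [hr, sub_apply, sum_apply, smul_apply,
        smul_eq_mul, sub_mul, Finset.sum_mul, mul_assoc]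
    simp_rw [e]
    rw [integral_sub (integrable_schwartz_mul _ _) (integrable_finsetSum _ fun j _ =>
      (integrable_schwartz_mul _ _).const_mul _), integral_finsetSum _ fun j _ =>
      (integrable_schwartz_mul _ _).const_mul _]
    simp_rw [integral_const_mul, integral_hermiteFun_mul]
    simp only [mul_ite, mul_one, mul_zero]
    rw [Finset.sum_ite_eq', if_pos hk, sub_self]
  have h0 := hP.integral_eval_mul_chaosH_of_orthogonal α r horth
  have e : ∀ ω : Omega, (ω s : ℝ) * chaosH α ω = ω r * chaosH α ω +
      ∑ k ∈ α.support, a k * (ω (hermiteFun k) * chaosH α ω) := by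
    intro ω
    have : s = r + ∑ k ∈ α.support, a k • hermiteFun k := by rw [hr, sub_add_cancel]
    conv_lhs => rw [this]
    rw [map_add, map_sum, add_mul, Finset.sum_mul]
    simp only [map_smul, smul_eq_mul, mul_assoc]
  simp_rw [e]
  rw [integral_add (integrable_eval_mul_chaosH hP _ _) (integrable_finsetSum _ fun j _ =>
      (integrable_eval_mul_chaosH hP _ _).const_mul _), h0, zero_add,
    integral_finsetSum _ fun j _ => (integrable_eval_mul_chaosH hP _ _).const_mul _, firstChaos]
  push_cast
  refine Finset.sum_congr rfl fun k hk => ?_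
  rw [integral_const_mul, hP.integral_hermiteFun_mul_chaosH α hk]
  split_ifs <;> simp [ha]

/-- The functional `f ↦ ∫ f g` on complex `L²`, for real valued square integrable `g`. -/
theorem continuous_integral_mul_ofReal {X : Type*} [MeasurableSpace X] {μ : Measure X}
    {g : X → ℝ} (hg : MemLp g 2 μ) :
    Continuous fun F : Lp ℂ 2 μ => ∫ x, F x * (g x : ℂ) ∂μ := by
  have h : (fun F : Lp ℂ 2 μ => ∫ x, F x * (g x : ℂ) ∂μ) =
      fun F => inner ℂ ((hg.ofReal (K := ℂ)).toLp) F := by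
    funext F
    rw [L2.inner_def]
    refine integral_congr_ae ?_
    filter_upwards [(hg.ofReal (K := ℂ)).coeFn_toLp] with x hx
    rw [hx]
    simp
  rw [h]
  fun_prop

/-- The chaos expansion of `Q_f` is the first order series of the Hermite coefficients of `f`. -/
theorem chaosExpansion_Q {P : Measure Omega} (hP : IsWhiteNoise P) (f : L2) :
    chaosExpansion (Q hP f) = firstChaos fun k => ∫ x, f x * (hermiteFun k x : ℂ) := by
  funext α
  -- At a fixed `α` both sides are continuous in `f`, so Schwartz functions suffice; there the real
  -- and imaginary parts are treated separately.
  refine DenseRange.induction_on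
    (SchwartzMap.denseRange_toLpCLM (p := 2) (μ := (volume : Measure ℝ)) (F := ℂ) (by simp))
    (p := fun f : L2 => chaosExpansion (Q hP f) α =
      firstChaos (fun k => ∫ x, f x * (hermiteFun k x : ℂ)) α) f ?_ ?_
  · refine isClosed_eq ?_ ?_
    · have hH : MemLp (chaosH α) 2 P := by exact_mod_cast hP.memLp_chaosH α 2
      exact ((continuous_integral_mul_ofReal hH).comp (Q hP).continuous).div_const _
    · refine continuous_finsetSum _ fun k _ => ?_
      split_ifs
      · exact continuous_integral_mul_ofReal ((hermiteFun k).memLp 2 volume)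
      · exact continuous_const
  · intro s
    rw [SchwartzMap.toLpCLM_apply, Q_toLp]
    set u := SchwartzMap.postcompCLM Complex.reCLM s with hu
    set v := SchwartzMap.postcompCLM Complex.imCLM s with hv
    have hL : ∫ ω, (hP.memLp_pairing s).toLp (pairing s) ω * (chaosH α ω : ℂ) ∂P =
        ((∫ ω, (ω u : ℝ) * chaosH α ω ∂P : ℝ) : ℂ) +
          Complex.I * ((∫ ω, (ω v : ℝ) * chaosH α ω ∂P : ℝ) : ℂ) := by
      rw [← integral_complex_ofReal, ← integral_complex_ofReal, ← integral_const_mul,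
        ← integral_add (integrable_eval_mul_chaosH hP u α).ofReal
          ((integrable_eval_mul_chaosH hP v α).ofReal.const_mul _)]
      refine integral_congr_ae ?_
      filter_upwards [(hP.memLp_pairing s).coeFn_toLp] with ω hω
      rw [hω, pairing]
      push_cast; ring
    have hR : ∀ k, ∫ x, (s.toLp 2 : L2) x * (hermiteFun k x : ℂ) =
        ((∫ x, u x * hermiteFun k x : ℝ) : ℂ) +
          Complex.I * ((∫ x, v x * hermiteFun k x : ℝ) : ℂ) := by
      intro k
      rw [← integral_complex_ofReal, ← integral_complex_ofReal, ← integral_const_mul,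
        ← integral_add (integrable_schwartz_mul u _).ofReal
          ((integrable_schwartz_mul v _).ofReal.const_mul _)]
      refine integral_congr_ae ?_
      filter_upwards [s.coeFn_toLp 2 volume] with x hx
      have : s x = (u x : ℂ) + Complex.I * (v x : ℂ) := by
        apply Complex.ext <;> simp [hu, hv]
      rw [hx, this]
      push_cast; ring
    rw [chaosExpansion, hL, hP.integral_eval_mul_chaosH, hP.integral_eval_mul_chaosH]
    simp_rw [hR]
    by_cases hα : α ∈ Set.range fun k => Finsupp.single k 1
    · obtain ⟨k, rfl⟩ := hα
      simp [firstChaos_single, idxFactorial]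
    · simp [firstChaos_of_notMem_range hα]

end MWhiteNoise

namespace MWhiteNoise

/-! ### Differentiation of first order series -/

theorem single_one_injective : Function.Injective fun k : ℕ => (Finsupp.single k 1 : Idx) :=
  Finsupp.single_left_injective one_ne_zero

theorem idxWeight_single (k : ℕ) : idxWeight (Finsupp.single k 1) = 2 * ((k : ℝ) + 1) := by
  simp [idxWeight]

theorem idxMonomial_single (z : ℕ → ℂ) (k : ℕ) : idxMonomial z (Finsupp.single k 1) = z k := by
  simp [idxMonomial]

theorem kondratievNormSq_firstChaos (q : ℕ) (c : ℕ → ℂ) :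
    kondratievNormSq q (firstChaos c) =
      ∑' k : ℕ, ENNReal.ofReal (‖c k‖ ^ 2 / (2 * ((k : ℝ) + 1)) ^ q) := by
  rw [kondratievNormSq, ← single_one_injective.tsum_eq]
  · simp_rw [firstChaos_single, idxWeight_single]
  · intro α hα
    by_contra h
    exact hα (by simp [firstChaos_of_notMem_range h])

theorem hermiteTransform_firstChaos (c z : ℕ → ℂ) :
    hermiteTransform (firstChaos c) z = ∑' k, c k * z k := by
  rw [hermiteTransform, ← single_one_injective.tsum_eq]
  · simp_rw [firstChaos_single, idxMonomial_single]
  · intro α hα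
    by_contra h
    exact hα (by simp [firstChaos_of_notMem_range h])

theorem summable_firstChaos_mul_iff (c z : ℕ → ℂ) :
    Summable (fun α => firstChaos c α * idxMonomial z α) ↔ Summable fun k => c k * z k := by
  rw [← single_one_injective.summable_iff]
  · simp only [Function.comp_def, firstChaos_single, idxMonomial_single]
  · intro α hα
    rw [firstChaos_of_notMem_range hα, zero_mul]

theorem firstChaos_sub_div_sub (a b c : ℕ → ℂ) (h : ℂ) :
    (fun α => (firstChaos a α - firstChaos b α) / h - firstChaos c α) =
      firstChaos fun k => (a k - b k) / h - c k := by
  funext α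
  by_cases hα : α ∈ Set.range fun k => Finsupp.single k 1
  · obtain ⟨k, rfl⟩ := hα
    simp only [firstChaos_single]
  · simp [firstChaos_of_notMem_range hα]

theorem summable_one_div_succ_sq : Summable fun k : ℕ => 1 / ((k : ℝ) + 1) ^ 2 := by
  have h := (summable_nat_add_iff 1).2 (Real.summable_one_div_nat_pow.2 one_lt_two)
  simpa using h

/-- For linearly growing coefficients, 4 is the least integer exponent for which this comparison
yields a summable bound. -/
theorem sq_div_weight_le {c : ℂ} {M : ℝ} {k : ℕ} (h : ‖c‖ ≤ M * ((k : ℝ) + 1)) :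
    ‖c‖ ^ 2 / (2 * ((k : ℝ) + 1)) ^ 4 ≤ M ^ 2 * (1 / ((k : ℝ) + 1) ^ 2) := by
  have hk : (0 : ℝ) < (k : ℝ) + 1 := by positivity
  have h2 : ‖c‖ ^ 2 ≤ (M * ((k : ℝ) + 1)) ^ 2 := by gcongr
  calc ‖c‖ ^ 2 / (2 * ((k : ℝ) + 1)) ^ 4
      ≤ (M * ((k : ℝ) + 1)) ^ 2 / ((k : ℝ) + 1) ^ 4 := by
        gcongr
        linarith
    _ = _ := by field_simp

theorem summable_sq_div_weight {c : ℕ → ℂ} {M : ℝ} (h : ∀ k, ‖c k‖ ≤ M * ((k : ℝ) + 1)) :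
    Summable fun k : ℕ => ‖c k‖ ^ 2 / (2 * ((k : ℝ) + 1)) ^ 4 :=
  .of_nonneg_of_le (fun k => by positivity) (fun k => sq_div_weight_le (h k))
    (summable_one_div_succ_sq.mul_left (M ^ 2))

theorem kondratievNormSq_four_firstChaos {c : ℕ → ℂ} {M : ℝ}
    (h : ∀ k, ‖c k‖ ≤ M * ((k : ℝ) + 1)) :
    kondratievNormSq 4 (firstChaos c) =
      ENNReal.ofReal (∑' k : ℕ, ‖c k‖ ^ 2 / (2 * ((k : ℝ) + 1)) ^ 4) := by
  rw [kondratievNormSq_firstChaos, ENNReal.ofReal_tsum_of_nonneg (fun k => by positivity)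
    (summable_sq_div_weight h)]

theorem isKondratiev_firstChaos {c : ℕ → ℂ} {M : ℝ} (h : ∀ k, ‖c k‖ ≤ M * ((k : ℝ) + 1)) :
    IsKondratiev (firstChaos c) :=
  ⟨4, by rw [kondratievNormSq_four_firstChaos h]; exact ENNReal.ofReal_lt_top⟩

/-- On `K_4(δ)` the series `∑ k |z_k|` converges, with a uniform bound. -/
theorem summable_mul_of_mem_nbhdK {δ : ℝ} {z : ℕ → ℂ} (hz : z ∈ nbhdK 4 δ) :
    Summable (fun k : ℕ => ((k : ℝ) + 1) * ‖z k‖) ∧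
      ∑' k : ℕ, ((k : ℝ) + 1) * ‖z k‖ ≤ ∑' k : ℕ, 1 / ((k : ℝ) + 1) ^ 2 + δ ^ 2 := by
  set w : ℕ → ℝ := fun k => ‖z k‖ ^ 2 * (2 * ((k : ℝ) + 1)) ^ 4 with hw
  have hw0 : ∀ k, 0 ≤ w k := fun k => by positivity
  have h1 : ∑' k, ENNReal.ofReal (w k) ≤ ENNReal.ofReal (δ ^ 2) := by
    refine le_trans ?_ (le_of_lt hz)
    -- Of the sum defining `K_4(δ)` only the terms at unit sequences are kept.
    have := ENNReal.tsum_comp_le_tsum_of_injective single_one_injective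
      fun α => ENNReal.ofReal (‖idxMonomial z α‖ ^ 2 * idxWeight α ^ 4)
    simpa only [idxMonomial_single, idxWeight_single] using this
  have hsum : Summable w := by
    have h2 := ENNReal.summable_toReal (ne_top_of_le_ne_top ENNReal.ofReal_ne_top h1)
    simpa only [ENNReal.toReal_ofReal (hw0 _)] using h2
  have h3 : ∑' k, w k ≤ δ ^ 2 := by
    rwa [← ENNReal.ofReal_tsum_of_nonneg hw0 hsum, ENNReal.ofReal_le_ofReal_iff (sq_nonneg δ)]
      at h1
  -- With `k + 1` written as `k`: split `k |z_k|` as `k⁻¹ · k² |z_k|` and use `a b ≤ a² + b²`; the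
  -- second square is `w k / 16`.
  have hle : ∀ k : ℕ, ((k : ℝ) + 1) * ‖z k‖ ≤ 1 / ((k : ℝ) + 1) ^ 2 + w k := by
    intro k
    have hk : (0 : ℝ) < (k : ℝ) + 1 := by positivity
    have e1 : ((k : ℝ) + 1) * ‖z k‖ = (1 / ((k : ℝ) + 1)) * (‖z k‖ * ((k : ℝ) + 1) ^ 2) := by
      field_simp
    have e2 : w k = 16 * (‖z k‖ * ((k : ℝ) + 1) ^ 2) ^ 2 := by simp only [hw]; ring
    have e3 : 1 / ((k : ℝ) + 1) ^ 2 = (1 / ((k : ℝ) + 1)) ^ 2 := by rw [div_pow, one_pow]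
    rw [e1, e2, e3]
    nlinarith [sq_nonneg (1 / ((k : ℝ) + 1) - ‖z k‖ * ((k : ℝ) + 1) ^ 2),
      sq_nonneg (1 / ((k : ℝ) + 1)), sq_nonneg (‖z k‖ * ((k : ℝ) + 1) ^ 2)]
  have hs : Summable (fun k : ℕ => ((k : ℝ) + 1) * ‖z k‖) :=
    .of_nonneg_of_le (fun k => by positivity) hle (summable_one_div_succ_sq.add hsum)
  refine ⟨hs, (hs.tsum_le_tsum hle (summable_one_div_succ_sq.add hsum)).trans ?_⟩
  rw [summable_one_div_succ_sq.tsum_add hsum]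
  gcongr

/-! ### Termwise differentiation under a linear growth bound on the derivatives. -/

section

variable {c d : ℝ → ℕ → ℂ} {D : ℝ} (hc : ∀ t k, HasDerivAt (fun s => c s k) (d t k) t)
  (hd : ∀ t k, ‖d t k‖ ≤ D * ((k : ℝ) + 1)) (hc0 : ∀ k, c 0 k = 0)

include hc hd in
theorem norm_coeff_sub_le (s t : ℝ) (k : ℕ) :
    ‖c s k - c t k‖ ≤ D * ((k : ℝ) + 1) * |s - t| :=
  convex_univ.norm_image_sub_le_of_norm_hasDerivWithin_le
    (fun x _ => (hc x k).hasDerivWithinAt) (fun x _ => hd x k) (Set.mem_univ t) (Set.mem_univ s)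

include hc hd hc0 in
theorem norm_coeff_le (t : ℝ) (k : ℕ) : ‖c t k‖ ≤ D * |t| * ((k : ℝ) + 1) := by
  have h := norm_coeff_sub_le hc hd t 0 k
  rw [hc0, sub_zero, sub_zero] at h
  linarith

include hc hd hc0 in
-- The mean value inequality bounds every difference quotient by the bound for the derivative, so
-- the errors are at most `2 D (k + 1)` uniformly in `h`. They tend to zero for each `k`, and
-- dominated convergence in the weight with `q = 4` concludes.
theorem hasKondratievDeriv_firstChaos :
    HasKondratievDeriv (fun t => firstChaos (c t)) (fun t => firstChaos (d t)) := by
  refine ⟨fun t => isKondratiev_firstChaos (norm_coeff_le hc hd hc0 t),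
    fun t => isKondratiev_firstChaos (hd t), fun t => ⟨4, ?_⟩⟩
  simp_rw [firstChaos_sub_div_sub]
  have hbd : ∀ h : ℝ, h ≠ 0 → ∀ k, ‖(c (t + h) k - c t k) / (h : ℂ) - d t k‖ ≤
      2 * D * ((k : ℝ) + 1) := by
    intro h hh k
    have e1 : ‖(c (t + h) k - c t k) / (h : ℂ)‖ ≤ D * ((k : ℝ) + 1) := by
      rw [norm_div, Complex.norm_real, Real.norm_eq_abs, div_le_iff₀ (abs_pos.2 hh)]
      simpa using norm_coeff_sub_le hc hd (t + h) t k
    refine (norm_sub_le _ _).trans ((add_le_add e1 (hd t k)).trans (le_of_eq (by ring)))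
  have hlim : Tendsto (fun h : ℝ => ∑' k : ℕ,
      ‖(c (t + h) k - c t k) / (h : ℂ) - d t k‖ ^ 2 / (2 * ((k : ℝ) + 1)) ^ 4)
      (𝓝[≠] 0) (𝓝 (∑' _ : ℕ, (0 : ℝ))) := by
    refine tendsto_tsum_of_dominated_convergence
      (bound := fun k : ℕ => (2 * D) ^ 2 * (1 / ((k : ℝ) + 1) ^ 2))
      (summable_one_div_succ_sq.mul_left _) (fun k => ?_) ?_
    · have h1 := (hc t k).tendsto_slope_zero
      have h2 : Tendsto (fun h : ℝ => (c (t + h) k - c t k) / (h : ℂ) - d t k) (𝓝[≠] 0)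
          (𝓝 (d t k - d t k)) := by
        refine (h1.congr fun h => ?_).sub_const _
        rw [Complex.real_smul, Complex.ofReal_inv, inv_mul_eq_div]
      simpa using (h2.norm.pow 2).div_const ((2 * ((k : ℝ) + 1)) ^ 4)
    · filter_upwards [self_mem_nhdsWithin] with h hh k
      rw [Real.norm_of_nonneg (by positivity)]
      exact sq_div_weight_le (hbd h hh k)
  rw [tsum_zero] at hlim
  have hlim' := ENNReal.tendsto_ofReal hlim
  rw [ENNReal.ofReal_zero] at hlim'
  refine hlim'.congr' ?_
  filter_upwards [self_mem_nhdsWithin] with h hh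
  exact (kondratievNormSq_four_firstChaos (hbd h hh)).symm

include hc hd hc0 in
-- The differentiated series is dominated by `D ∑ (k + 1) |z_k|`, which does not involve `t` and is
-- bounded on `K_4(δ)`. This permits termwise differentiation and bounds the derivative; the mean
-- value inequality passes the same constant to the difference quotients.
theorem hasHermiteDerivBoundedly_firstChaos (δ : ℝ) :
    HasHermiteDerivBoundedly 4 δ (fun t => firstChaos (c t)) (fun t => firstChaos (d t)) := by
  have hD : 0 ≤ D := by simpa using (norm_nonneg _).trans (hd 0 0)
  have hbd : ∀ z : ℕ → ℂ, ∀ t k, ‖d t k * z k‖ ≤ D * (((k : ℝ) + 1) * ‖z k‖) := by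
    intro z t k
    rw [norm_mul, ← mul_assoc]
    gcongr
    exact hd t k
  have hsc : ∀ z ∈ nbhdK 4 δ, ∀ t, Summable fun k => c t k * z k := by
    intro z hz t
    refine .of_norm_bounded ((summable_mul_of_mem_nbhdK hz).1.mul_left (D * |t|)) fun k => ?_
    rw [norm_mul, ← mul_assoc]
    gcongr
    exact norm_coeff_le hc hd hc0 t k
  have hsd : ∀ z ∈ nbhdK 4 δ, ∀ t, Summable fun k => d t k * z k := fun z hz t =>
    .of_norm_bounded ((summable_mul_of_mem_nbhdK hz).1.mul_left D) (hbd z t)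
  have hder : ∀ z ∈ nbhdK 4 δ, ∀ t, HasDerivAt (fun s => hermiteTransform (firstChaos (c s)) z)
      (hermiteTransform (firstChaos (d t)) z) t := by
    intro z hz t
    simp_rw [hermiteTransform_firstChaos]
    exact hasDerivAt_tsum ((summable_mul_of_mem_nbhdK hz).1.mul_left D)
      (fun k s => (hc s k).mul_const (z k)) (fun k s => hbd z s k) (hsc z hz 0) t
  have hY : ∀ z ∈ nbhdK 4 δ, ∀ t, ‖hermiteTransform (firstChaos (d t)) z‖ ≤
      D * (∑' k : ℕ, 1 / ((k : ℝ) + 1) ^ 2 + δ ^ 2) := by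
    intro z hz t
    obtain ⟨h1, h2⟩ := summable_mul_of_mem_nbhdK hz
    rw [hermiteTransform_firstChaos]
    refine (tsum_of_norm_bounded (h1.mul_left D).hasSum (hbd z t)).trans ?_
    rw [tsum_mul_left]
    gcongr
  refine ⟨fun t z hz => ⟨(summable_firstChaos_mul_iff _ _).2 (hsc z hz t),
    (summable_firstChaos_mul_iff _ _).2 (hsd z hz t), hder z hz t⟩,
    D * (∑' k : ℕ, 1 / ((k : ℝ) + 1) ^ 2 + δ ^ 2), fun t z hz => ⟨hY z hz t, fun h hh => ?_⟩⟩
  rw [norm_div, Complex.norm_real, Real.norm_eq_abs, div_le_iff₀ (abs_pos.2 hh)]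
  have h := convex_univ.norm_image_sub_le_of_norm_hasDerivWithin_le
    (fun x _ => (hder z hz x).hasDerivWithinAt) (fun x _ => hY z hz x) (Set.mem_univ t)
    (Set.mem_univ (t + h))
  simpa using h

end

end MWhiteNoise

namespace MWhiteNoise

/-! ### The Fourier transform on `L¹ ∩ L²` -/

/-- Compactly supported smooth functions are Schwartz, so equality as tempered distributions forces
equality almost everywhere. This links the `L²` Fourier transform to the Fourier integral. -/
theorem toLp_ext_of_integral_schwartz {f : L2} {g : ℝ → ℂ} (hg : LocallyIntegrable g)
    (h : ∀ η : 𝓢(ℝ, ℂ), ∫ x, η x * f x = ∫ x, η x * g x) : f =ᵐ[volume] g := by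
  refine ae_eq_of_integral_contDiff_smul_eq
    ((Lp.memLp f).locallyIntegrable (by norm_num)) hg fun η hη hηc => ?_
  have hη' : ContDiff ℝ ((⊤ : ℕ∞) : WithTop ℕ∞) fun x => (η x : ℂ) :=
    Complex.ofRealCLM.contDiff.comp hη
  have hc : HasCompactSupport fun x => (η x : ℂ) := hηc.comp_left Complex.ofReal_zero
  simpa [Complex.real_smul] using h (hc.toSchwartzMap hη')

theorem integral_fourier_mul {f g : ℝ → ℂ} (hf : Integrable f) (hg : Integrable g) :
    ∫ x, 𝓕 f x * g x = ∫ x, f x * 𝓕 g x := by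
  have h := VectorFourier.integral_fourierIntegral_smul_eq_flip (L := innerₗ ℝ)
    Real.continuous_fourierChar continuous_inner hf hg
  simpa [Real.fourier_eq, VectorFourier.fourierIntegral, real_inner_comm] using h

theorem integral_fourierInv_mul {f g : ℝ → ℂ} (hf : Integrable f) (hg : Integrable g) :
    ∫ x, 𝓕⁻ f x * g x = ∫ x, f x * 𝓕⁻ g x := by
  simp_rw [Real.fourierInv_eq_fourier_neg]
  rw [← integral_neg_eq_self]
  simp_rw [neg_neg]
  rw [integral_fourier_mul hf hg.comp_neg]
  congr 1
  funext x
  congr 1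
  simp_rw [← Real.fourierInv_eq_fourier_neg, Real.fourierInv_eq_fourier_comp_neg]

theorem continuous_fourier {g : ℝ → ℂ} (h1 : Integrable g) : Continuous (𝓕 g) :=
  VectorFourier.fourierIntegral_continuous Real.continuous_fourierChar continuous_inner h1

theorem continuous_fourierInv {g : ℝ → ℂ} (h1 : Integrable g) : Continuous (𝓕⁻ g) := by
  have : 𝓕⁻ g = fun x => 𝓕 g (-x) := funext (Real.fourierInv_eq_fourier_neg g)
  rw [this]
  exact (continuous_fourier h1).comp continuous_neg

/-- The `L²` Fourier transform of an integrable function is given by the Fourier integral. -/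
theorem fourier_toLp_ae_eq {g : ℝ → ℂ} (h1 : Integrable g) (h2 : MemLp g 2) :
    (𝓕 (h2.toLp g : L2) : L2) =ᵐ[volume] 𝓕 g := by
  refine toLp_ext_of_integral_schwartz (continuous_fourier h1).locallyIntegrable fun η => ?_
  -- The distributional transform acts by duality on `η`; the multiplication formula moves it back
  -- to `g` as an integral.
  have h := congrArg (fun T => T η) (Lp.fourier_toTemperedDistribution_eq (h2.toLp g : L2))
  simp only [TemperedDistribution.fourier_apply, Lp.toTemperedDistribution_apply,
    smul_eq_mul] at h
  rw [← h, ← integral_fourier_mul η.integrable h1]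
  refine integral_congr_ae ?_
  filter_upwards [h2.coeFn_toLp] with x hx
  rw [hx, SchwartzMap.fourier_coe]

/-- The `L²` inverse Fourier transform of an integrable function is given by the inverse
Fourier integral. -/
theorem fourierInv_toLp_ae_eq {g : ℝ → ℂ} (h1 : Integrable g) (h2 : MemLp g 2) :
    (𝓕⁻ (h2.toLp g : L2) : L2) =ᵐ[volume] 𝓕⁻ g := by
  refine toLp_ext_of_integral_schwartz (continuous_fourierInv h1).locallyIntegrable fun η => ?_
  have h := congrArg (fun T => T η) (Lp.fourierInv_toTemperedDistribution_eq (h2.toLp g : L2))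
  simp only [TemperedDistribution.fourierInv_apply, Lp.toTemperedDistribution_apply,
    smul_eq_mul] at h
  rw [← h, ← integral_fourierInv_mul η.integrable h1]
  refine integral_congr_ae ?_
  filter_upwards [h2.coeFn_toLp] with x hx
  rw [hx, SchwartzMap.fourierInv_coe]

/-! ### The multiplier `√m` -/

section

variable {m : ℝ → ℝ}

theorem measurable_symbol (hm_meas : Measurable m) : Measurable (symbol m) := by
  unfold symbol
  fun_prop

theorem norm_symbol_sq (hm_nonneg : ∀ u, 0 ≤ m u) (ξ : ℝ) :
    ‖symbol m ξ‖ ^ 2 = m (2 * Real.pi * ξ) := by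
  rw [symbol, Complex.norm_real, Real.norm_eq_abs, sq_abs, Real.sq_sqrt (hm_nonneg _)]

theorem integrable_symbol_weight (hm_int : Integrable (fun u : ℝ => m u / (u ^ 2 + 1))) :
    Integrable fun ξ : ℝ => m (2 * Real.pi * ξ) / ((2 * Real.pi * ξ) ^ 2 + 1) :=
  hm_int.comp_mul_left' (by positivity)

/-- If `(1 + u²) |ĝ(u)|²` is bounded, then `√m ĝ` is square integrable. -/
theorem memLp_symbol_mul (hm_meas : Measurable m) (hm_nonneg : ∀ u, 0 ≤ m u)
    (hm_int : Integrable (fun u : ℝ => m u / (u ^ 2 + 1))) {g : ℝ → ℂ}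
    (hg : AEStronglyMeasurable g) {C : ℝ}
    (hC : ∀ᵐ ξ : ℝ, ((2 * Real.pi * ξ) ^ 2 + 1) * ‖g ξ‖ ^ 2 ≤ C) :
    MemLp (fun ξ => symbol m ξ * g ξ) 2 := by
  have hmeas : AEStronglyMeasurable fun ξ => symbol m ξ * g ξ :=
    (measurable_symbol hm_meas).aestronglyMeasurable.mul hg
  rw [memLp_two_iff_integrable_sq_norm hmeas]
  refine ((integrable_symbol_weight hm_int).const_mul C).mono' (hmeas.norm.pow 2) ?_
  filter_upwards [hC] with ξ hξ
  rw [Real.norm_of_nonneg (by positivity), norm_mul, mul_pow,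
    norm_symbol_sq hm_nonneg, ← mul_div_assoc, le_div_iff₀ (by positivity)]
  nlinarith [mul_le_mul_of_nonneg_left hξ (hm_nonneg (2 * Real.pi * ξ))]

/-- With `w = 1 + u²` this is `a b ≤ a² / w + w b²`. The first term is integrable by the assumption
on `m`; the second integrates to a Sobolev norm when `g` is a Fourier transform. -/
theorem norm_symbol_mul_le (hm_nonneg : ∀ u, 0 ≤ m u) (g : ℝ → ℂ) (ξ : ℝ) :
    ‖symbol m ξ * g ξ‖ ≤ m (2 * Real.pi * ξ) / ((2 * Real.pi * ξ) ^ 2 + 1) +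
      ((2 * Real.pi * ξ) ^ 2 + 1) * ‖g ξ‖ ^ 2 := by
  have hpos : 0 < (2 * Real.pi * ξ) ^ 2 + 1 := by positivity
  rw [norm_mul, ← norm_symbol_sq hm_nonneg ξ]
  set w := (2 * Real.pi * ξ) ^ 2 + 1
  set a := ‖symbol m ξ‖
  set b := ‖g ξ‖
  rw [div_add' _ _ _ hpos.ne', le_div_iff₀ hpos]
  nlinarith [sq_nonneg (a - w * b), sq_nonneg a, sq_nonneg (w * b)]

theorem integrable_schwartz_weight (f : 𝓢(ℝ, ℂ)) :
    Integrable fun ξ : ℝ => ((2 * Real.pi * ξ) ^ 2 + 1) * ‖f ξ‖ ^ 2 := by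
  have h1 : Integrable fun ξ => ‖f ξ‖ ^ 2 := (f.memLp 2 volume).integrable_norm_pow (by simp)
  have h2 : Integrable fun ξ : ℝ => ‖ξ * f ξ‖ ^ 2 := by
    have h := ((SchwartzMap.smulLeftCLM ℂ (fun x : ℝ => (x : ℂ)) f).memLp 2
      volume).integrable_norm_pow (by simp)
    refine h.congr (Eventually.of_forall fun x => ?_)
    simp only
    rw [SchwartzMap.smulLeftCLM_apply_apply (by fun_prop)]
    simp
  refine ((h2.const_mul ((2 * Real.pi) ^ 2)).add h1).congr (Eventually.of_forall fun ξ => ?_)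
  simp only [Pi.add_apply, norm_mul, mul_pow, Complex.norm_real, Real.norm_eq_abs, sq_abs]
  ring

theorem fourier_deriv_schwartz (f : 𝓢(ℝ, ℂ)) (ξ : ℝ) :
    𝓕 (SchwartzMap.derivCLM ℂ ℂ f) ξ = (2 * Real.pi * Complex.I * ξ) * 𝓕 f ξ := by
  have h := Real.fourier_deriv f.integrable f.differentiable
    (SchwartzMap.derivCLM ℂ ℂ f).integrable
  have h2 := congrFun h ξ
  rw [smul_eq_mul] at h2
  rw [SchwartzMap.fourier_coe, SchwartzMap.fourier_coe, ← h2]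
  rfl

/-- `∫ (1 + u²) |f̂|² = ‖f‖² + ‖f'‖²`. -/
theorem integral_weight_fourier (f : 𝓢(ℝ, ℂ)) :
    ∫ ξ : ℝ, ((2 * Real.pi * ξ) ^ 2 + 1) * ‖𝓕 f ξ‖ ^ 2 =
      (∫ x, ‖deriv f x‖ ^ 2) + ∫ x, ‖f x‖ ^ 2 := by
  have h1 := SchwartzMap.integral_norm_sq_fourier f
  have h2 := SchwartzMap.integral_norm_sq_fourier (SchwartzMap.derivCLM ℂ ℂ f)
  have i1 : Integrable fun ξ => ‖𝓕 f ξ‖ ^ 2 :=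
    ((𝓕 f).memLp 2 volume).integrable_norm_pow (by simp)
  have i2 : Integrable fun ξ => ‖𝓕 (SchwartzMap.derivCLM ℂ ℂ f) ξ‖ ^ 2 :=
    ((𝓕 (SchwartzMap.derivCLM ℂ ℂ f)).memLp 2 volume).integrable_norm_pow (by simp)
  simp only [SchwartzMap.derivCLM_apply] at h2
  rw [← h1, ← h2, ← integral_add i2 i1]
  congr 1
  funext ξ
  rw [fourier_deriv_schwartz]
  simp only [norm_mul, mul_pow, Complex.norm_real, Real.norm_eq_abs, sq_abs, Complex.norm_I]
  simp
  ring

theorem memLp_symbol_mul_fourier (hm_meas : Measurable m) (hm_nonneg : ∀ u, 0 ≤ m u)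
    (hm_int : Integrable (fun u : ℝ => m u / (u ^ 2 + 1))) (f : 𝓢(ℝ, ℂ)) :
    MemLp (fun ξ => symbol m ξ * (𝓕 f) ξ) 2 := by
  obtain ⟨C₀, -, hC₀⟩ := (𝓕 f).decay 0 0
  obtain ⟨C₁, -, hC₁⟩ := (𝓕 f).decay 1 0
  refine memLp_symbol_mul hm_meas hm_nonneg hm_int (𝓕 f).continuous.aestronglyMeasurable
    (C := (2 * Real.pi) ^ 2 * C₁ ^ 2 + C₀ ^ 2) (Eventually.of_forall fun ξ => ?_)
  have e0 := hC₀ ξ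
  have e1 := hC₁ ξ
  simp only [pow_zero, one_mul, norm_iteratedFDeriv_zero, pow_one] at e0 e1
  have e2 : (‖ξ‖ * ‖𝓕 f ξ‖) ^ 2 ≤ C₁ ^ 2 := by gcongr
  have e3 : ‖𝓕 f ξ‖ ^ 2 ≤ C₀ ^ 2 := by gcongr
  rw [mul_pow, Real.norm_eq_abs, sq_abs] at e2
  have e4 := mul_le_mul_of_nonneg_left e2 (sq_nonneg (2 * Real.pi))
  calc _ = (2 * Real.pi) ^ 2 * (ξ ^ 2 * ‖𝓕 f ξ‖ ^ 2) + ‖𝓕 f ξ‖ ^ 2 := by ring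
    _ ≤ _ := add_le_add e4 e3

theorem integrable_symbol_mul_fourier (hm_meas : Measurable m) (hm_nonneg : ∀ u, 0 ≤ m u)
    (hm_int : Integrable (fun u : ℝ => m u / (u ^ 2 + 1))) (f : 𝓢(ℝ, ℂ)) :
    Integrable fun ξ => symbol m ξ * (𝓕 f) ξ :=
  ((integrable_symbol_weight hm_int).add (integrable_schwartz_weight (𝓕 f))).mono'
    ((measurable_symbol hm_meas).aestronglyMeasurable.mul
      (𝓕 f).continuous.aestronglyMeasurable)
    (Eventually.of_forall fun ξ => norm_symbol_mul_le hm_nonneg (𝓕 f : 𝓢(ℝ, ℂ)) ξ)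

/-- The `L¹` norm of `√m f̂` bounds its inverse Fourier integral at every `t`, and the weighted
splitting with Plancherel evaluates the bound. -/
theorem norm_opTFun_le (hm_meas : Measurable m) (hm_nonneg : ∀ u, 0 ≤ m u)
    (hm_int : Integrable (fun u : ℝ => m u / (u ^ 2 + 1))) (f : 𝓢(ℝ, ℂ)) (t : ℝ) :
    ‖opTFun m f t‖ ≤ (∫ ξ : ℝ, m (2 * Real.pi * ξ) / ((2 * Real.pi * ξ) ^ 2 + 1)) +
      ((∫ x, ‖deriv f x‖ ^ 2) + ∫ x, ‖f x‖ ^ 2) := by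
  rw [opTFun, Real.fourierInv_eq_fourier_neg]
  refine (VectorFourier.norm_fourierIntegral_le_integral_norm _ _ _ _ _).trans ?_
  rw [← integral_weight_fourier, ← integral_add (integrable_symbol_weight hm_int)
    (integrable_schwartz_weight (𝓕 f))]
  exact integral_mono (integrable_symbol_mul_fourier hm_meas hm_nonneg hm_int f).norm
    ((integrable_symbol_weight hm_int).add (integrable_schwartz_weight (𝓕 f)))
    fun ξ => norm_symbol_mul_le hm_nonneg (𝓕 f : 𝓢(ℝ, ℂ)) ξ

theorem continuous_opTFun (hm_meas : Measurable m) (hm_nonneg : ∀ u, 0 ≤ m u)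
    (hm_int : Integrable (fun u : ℝ => m u / (u ^ 2 + 1))) (f : 𝓢(ℝ, ℂ)) :
    Continuous (opTFun m f) :=
  continuous_fourierInv (integrable_symbol_mul_fourier hm_meas hm_nonneg hm_int f)

theorem symbol_mul_fourier_toLp_ae_eq (f : 𝓢(ℝ, ℂ)) :
    (fun ξ => symbol m ξ * (𝓕 (f.toLp 2 : L2) : L2) ξ) =ᵐ[volume]
      fun ξ => symbol m ξ * (𝓕 f) ξ := by
  rw [SchwartzMap.toLp_fourier_eq]
  filter_upwards [(𝓕 f).coeFn_toLp 2 volume] with ξ hξ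
  rw [hξ]

theorem memDom_schwartz (hm_meas : Measurable m) (hm_nonneg : ∀ u, 0 ≤ m u)
    (hm_int : Integrable (fun u : ℝ => m u / (u ^ 2 + 1))) (f : 𝓢(ℝ, ℂ)) :
    MemDom m (f.toLp 2) :=
  (memLp_congr_ae (symbol_mul_fourier_toLp_ae_eq f)).2
    (memLp_symbol_mul_fourier hm_meas hm_nonneg hm_int f)

theorem opT_schwartz_ae_eq (hm_meas : Measurable m) (hm_nonneg : ∀ u, 0 ≤ m u)
    (hm_int : Integrable (fun u : ℝ => m u / (u ^ 2 + 1))) (f : 𝓢(ℝ, ℂ)) :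
    opT m (f.toLp 2) =ᵐ[volume] opTFun m f := by
  have hdom := memDom_schwartz hm_meas hm_nonneg hm_int f
  have h2 := memLp_symbol_mul_fourier hm_meas hm_nonneg hm_int f
  have h : opT m (f.toLp 2) = 𝓕⁻ (h2.toLp _ : L2) := by
    rw [opT, dif_pos hdom]
    congr 1
    exact MemLp.toLp_congr _ _ (symbol_mul_fourier_toLp_ae_eq f)
  rw [h]
  exact fourierInv_toLp_ae_eq (integrable_symbol_mul_fourier hm_meas hm_nonneg hm_int f) h2

/-- `T_m` is symmetric. -/
theorem inner_opT_comm {f g : L2} (hf : MemDom m f) (hg : MemDom m g) :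
    inner ℂ f (opT m g) = inner ℂ (opT m f) g := by
  -- By Plancherel both sides become integrals in frequency, where `√m` is a real multiplier and may
  -- sit on either factor.
  rw [← Lp.inner_fourier_eq f, ← Lp.inner_fourier_eq (opT m f), opT, opT, dif_pos hf,
    dif_pos hg, FourierTransform.fourier_fourierInv_eq, FourierTransform.fourier_fourierInv_eq,
    L2.inner_def, L2.inner_def]
  refine integral_congr_ae ?_
  filter_upwards [hf.coeFn_toLp, hg.coeFn_toLp] with ξ h1 h2
  rw [h1, h2]
  simp only [RCLike.inner_apply, map_mul, symbol, Complex.conj_ofReal]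
  ring

end

end MWhiteNoise

namespace MWhiteNoise

/-! ### The `m`-Brownian motion -/

theorem fourier_indicator_Icc {a b : ℝ} (hab : a ≤ b) (ξ : ℝ) :
    𝓕 ((Set.Icc a b).indicator fun _ => (1 : ℂ)) ξ =
      ∫ x in a..b, Complex.exp (((-2 * Real.pi * ξ : ℝ) : ℂ) * Complex.I * x) := by
  rw [Real.fourier_eq', intervalIntegral.integral_of_le hab, ← integral_Icc_eq_integral_Ioc,
    ← integral_indicator measurableSet_Icc]
  congr 1
  funext x
  by_cases hx : x ∈ Set.Icc a b
  · simp only [Set.indicator_of_mem hx, smul_eq_mul, mul_one]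
    congr 1
    simp
    ring
  · simp [Set.indicator_of_notMem hx]

/-- Two bounds are combined: the transform is at most the length `b - a`, and multiplied by `u =
2πξ` it is a difference of two unimodular numbers, hence at most `2`. This decay puts `I_t` in the
domain of `T_m`. -/
theorem weight_mul_fourier_indicator_Icc_le {a b : ℝ} (hab : a ≤ b) (ξ : ℝ) :
    ((2 * Real.pi * ξ) ^ 2 + 1) * ‖𝓕 ((Set.Icc a b).indicator fun _ => (1 : ℂ)) ξ‖ ^ 2 ≤
      4 + (b - a) ^ 2 := by
  have hexp : ∀ x : ℝ,
      ‖Complex.exp (((-2 * Real.pi * ξ : ℝ) : ℂ) * Complex.I * x)‖ = 1 := fun x => by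
    have : ((-2 * Real.pi * ξ : ℝ) : ℂ) * Complex.I * x =
        ((-2 * Real.pi * ξ * x : ℝ) : ℂ) * Complex.I := by push_cast; ring
    rw [this, Complex.norm_exp_ofReal_mul_I]
  set F := 𝓕 ((Set.Icc a b).indicator fun _ => (1 : ℂ)) ξ with hF
  have h1 : ‖F‖ ≤ b - a := by
    rw [hF, fourier_indicator_Icc hab]
    have := intervalIntegral.norm_integral_le_of_norm_le_const (a := a) (b := b) (C := 1)
      (f := fun x : ℝ => Complex.exp (((-2 * Real.pi * ξ : ℝ) : ℂ) * Complex.I * x))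
      fun x _ => (hexp x).le
    rwa [one_mul, abs_of_nonneg (sub_nonneg.2 hab)] at this
  have h2 : ‖((-2 * Real.pi * ξ : ℝ) : ℂ) * Complex.I * F‖ ≤ 2 := by
    by_cases hξ : ξ = 0
    · simp [hξ]
    · have hne : ((-2 * Real.pi * ξ : ℝ) : ℂ) * Complex.I ≠ 0 :=
        mul_ne_zero (by exact_mod_cast mul_ne_zero (by simp) hξ) Complex.I_ne_zero
      rw [hF, fourier_indicator_Icc hab, integral_exp_mul_complex hne, mul_div_cancel₀ _ hne]
      refine (norm_sub_le _ _).trans (le_of_eq ?_)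
      rw [hexp, hexp]; norm_num
  have h3 : ‖((-2 * Real.pi * ξ : ℝ) : ℂ) * Complex.I * F‖ ^ 2 ≤ 2 ^ 2 := by gcongr
  have h4 : ‖F‖ ^ 2 ≤ (b - a) ^ 2 := by gcongr
  rw [norm_mul, norm_mul, Complex.norm_I, Complex.norm_real, mul_one, mul_pow,
    Real.norm_eq_abs, sq_abs] at h3
  nlinarith

section

variable {m : ℝ → ℝ}

theorem memDom_indicatorConstLp_Icc (hm_meas : Measurable m) (hm_nonneg : ∀ u, 0 ≤ m u)
    (hm_int : Integrable (fun u : ℝ => m u / (u ^ 2 + 1))) {a b : ℝ} (hab : a ≤ b)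
    (hμ : volume (Set.Icc a b) ≠ ∞) :
    MemDom m (indicatorConstLp 2 (measurableSet_Icc : MeasurableSet (Set.Icc a b)) hμ (1 : ℂ)) := by
  have h1 : Integrable ((Set.Icc a b).indicator fun _ => (1 : ℂ)) :=
    (integrable_indicator_iff measurableSet_Icc).2 (integrableOn_const hμ)
  have h2 := memLp_indicator_const 2 (measurableSet_Icc : MeasurableSet (Set.Icc a b)) (1 : ℂ)
    (μ := volume) (Or.inr hμ)
  have h := fourier_toLp_ae_eq h1 h2
  refine memLp_symbol_mul hm_meas hm_nonneg hm_int (Lp.aestronglyMeasurable _)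
    (C := 4 + (b - a) ^ 2) ?_
  filter_upwards [h] with ξ hξ
  have e : (𝓕 (indicatorConstLp 2 (measurableSet_Icc : MeasurableSet (Set.Icc a b)) hμ
    (1 : ℂ) : L2) : L2) ξ = 𝓕 ((Set.Icc a b).indicator fun _ => (1 : ℂ)) ξ := hξ
  rw [e]
  exact weight_mul_fourier_indicator_Icc_le hab ξ

theorem MemDom.neg {f : L2} (hf : MemDom m f) : MemDom m (-f) := by
  refine (memLp_congr_ae ?_).2 (MemLp.neg hf)
  have h : (𝓕 (-f) : L2) = -𝓕 f := map_neg (FourierTransform.fourierCLM ℂ L2) f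
  rw [h]
  filter_upwards [Lp.coeFn_neg (𝓕 f : L2)] with ξ hξ
  rw [hξ]
  simp

theorem memDom_indicatorI (hm_meas : Measurable m) (hm_nonneg : ∀ u, 0 ≤ m u)
    (hm_int : Integrable (fun u : ℝ => m u / (u ^ 2 + 1))) (t : ℝ) :
    MemDom m (indicatorI t) := by
  rw [indicatorI]
  split_ifs with ht
  · exact memDom_indicatorConstLp_Icc hm_meas hm_nonneg hm_int ht _
  · exact (memDom_indicatorConstLp_Icc hm_meas hm_nonneg hm_int (not_le.1 ht).le _).neg

/-- The sign convention in `I_t` is the orientation convention of the interval integral. -/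
theorem integral_indicatorI_mul (t : ℝ) (g : ℝ → ℂ) :
    ∫ x, (indicatorI t) x * g x = ∫ x in (0 : ℝ)..t, g x := by
  have key : ∀ {a b : ℝ}, a ≤ b → ∀ hμ : volume (Set.Icc a b) ≠ ∞,
      ∫ x, (indicatorConstLp 2 (measurableSet_Icc : MeasurableSet (Set.Icc a b)) hμ (1 : ℂ)) x *
        g x = ∫ x in a..b, g x := by
    intro a b hab hμ
    rw [intervalIntegral.integral_of_le hab, ← integral_Icc_eq_integral_Ioc,
      ← integral_indicator measurableSet_Icc]
    refine integral_congr_ae ?_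
    filter_upwards [indicatorConstLp_coeFn (p := 2)
      (hs := (measurableSet_Icc : MeasurableSet (Set.Icc a b))) (hμs := hμ)
      (c := (1 : ℂ))] with x hx
    rw [hx]
    by_cases h : x ∈ Set.Icc a b <;> simp [h]
  rw [indicatorI]
  split_ifs with ht
  · exact key ht _
  · rw [intervalIntegral.integral_symm, ← key (not_le.1 ht).le (by simp), ← integral_neg]
    refine integral_congr_ae ?_
    filter_upwards [Lp.coeFn_neg (indicatorConstLp 2
      (measurableSet_Icc : MeasurableSet (Set.Icc t 0)) (by simp) (1 : ℂ))] with x hx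
    rw [hx]
    simp

/-- The Hermite coefficients of `T_m I_t`. -/
theorem integral_opT_indicatorI_mul (hm_meas : Measurable m) (hm_nonneg : ∀ u, 0 ≤ m u)
    (hm_int : Integrable (fun u : ℝ => m u / (u ^ 2 + 1))) (t : ℝ) (k : ℕ) :
    ∫ x, (opT m (indicatorI t)) x * (hermiteFun k x : ℂ) =
      ∫ s in (0 : ℝ)..t, conj (opTFun m (hermiteFunC k) s) := by
  -- The inner product conjugates its first argument. On the left that argument is the real function
  -- `h̃_k`, so no conjugate remains; on the right it is `T_m h̃_k`, whose conjugate stays.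
  have h := inner_opT_comm (memDom_schwartz hm_meas hm_nonneg hm_int (hermiteFunC k))
    (memDom_indicatorI hm_meas hm_nonneg hm_int t)
  rw [L2.inner_def, L2.inner_def] at h
  rw [← integral_indicatorI_mul]
  convert h using 1
  · refine integral_congr_ae ?_
    filter_upwards [(hermiteFunC k).coeFn_toLp 2 volume] with x hx
    rw [hx]
    simp [hermiteFunC]
  · refine integral_congr_ae ?_
    filter_upwards [opT_schwartz_ae_eq hm_meas hm_nonneg hm_int (hermiteFunC k)] with x hx
    rw [hx]
    simp

theorem norm_opTFun_hermiteFunC_le (hm_meas : Measurable m) (hm_nonneg : ∀ u, 0 ≤ m u)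
    (hm_int : Integrable (fun u : ℝ => m u / (u ^ 2 + 1))) (k : ℕ) (t : ℝ) :
    ‖opTFun m (hermiteFunC k) t‖ ≤
      ((∫ ξ : ℝ, m (2 * Real.pi * ξ) / ((2 * Real.pi * ξ) ^ 2 + 1)) + 2) * ((k : ℝ) + 1) := by
  have h := norm_opTFun_le hm_meas hm_nonneg hm_int (hermiteFunC k) t
  have h0 : 0 ≤ ∫ ξ : ℝ, m (2 * Real.pi * ξ) / ((2 * Real.pi * ξ) ^ 2 + 1) :=
    integral_nonneg fun ξ => div_nonneg (hm_nonneg _) (by positivity)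
  have h1 : ∫ x, ‖hermiteFunC k x‖ ^ 2 = 1 := by
    rw [← integral_hermiteFun_sq k]
    congr 1; funext x
    simp [hermiteFunC]
  have h2 : ∫ x, ‖deriv (hermiteFunC k) x‖ ^ 2 ≤ 2 * k + 1 := by
    refine le_trans (le_of_eq ?_) (integral_deriv_hermiteFun_sq_le k)
    congr 1; funext x
    have hd : HasDerivAt (hermiteFunC k) ((deriv (hermiteFun k) x : ℝ) : ℂ) x :=
      ((hermiteFun k).hasDerivAt x).ofReal_comp
    rw [hd.deriv, Complex.norm_real, Real.norm_eq_abs, sq_abs]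
  have hk : (0 : ℝ) ≤ k := Nat.cast_nonneg k
  -- With `M` for the integral, `M + (2k + 1) + 1 ≤ (M + 2)(k + 1)` since `M k ≥ 0`.
  nlinarith [mul_nonneg h0 hk]

/-- The coefficients of the `m`-Brownian motion. -/
theorem chaosExpansion_mBrownian {P : Measure Omega} (hP : IsWhiteNoise P)
    (hm_meas : Measurable m) (hm_nonneg : ∀ u, 0 ≤ m u)
    (hm_int : Integrable (fun u : ℝ => m u / (u ^ 2 + 1))) (t : ℝ) :
    chaosExpansion (mBrownian hP m t) =
      firstChaos fun k => ∫ s in (0 : ℝ)..t, conj (opTFun m (hermiteFunC k) s) := by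
  rw [mBrownian, chaosExpansion_Q]
  simp_rw [integral_opT_indicatorI_mul hm_meas hm_nonneg hm_int]

/-- For even `m`, the functions `T_m h̃_k` are real valued. -/
theorem conj_opTFun_hermiteFunC (hm_even : ∀ᵐ u : ℝ, m (-u) = m u) (k : ℕ) (t : ℝ) :
    conj (opTFun m (hermiteFunC k) t) = opTFun m (hermiteFunC k) t := by
  -- Real functions have conjugate symmetric Fourier transforms.
  have hF : ∀ ξ, conj ((𝓕 (hermiteFunC k)) ξ) = (𝓕 (hermiteFunC k)) (-ξ) := by
    intro ξ
    rw [SchwartzMap.fourier_coe, Real.fourier_eq', Real.fourier_eq', ← integral_conj]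
    congr 1
    funext x
    rw [smul_eq_mul, smul_eq_mul, map_mul, ← Complex.exp_conj]
    congr 1
    · congr 1
      rw [map_mul, Complex.conj_ofReal, Complex.conj_I]
      simp
    · simp [hermiteFunC]
  have hm : ∀ᵐ ξ : ℝ, symbol m (-ξ) = symbol m ξ := by
    -- Evenness holds only almost everywhere, so the scaling `u = 2πξ` must pull null sets back to
    -- null sets.
    have hq : Measure.QuasiMeasurePreserving (fun ξ : ℝ => 2 * Real.pi * ξ) volume volume := by
      refine ⟨by fun_prop, ?_⟩
      rw [Real.map_volume_mul_left (by positivity)]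
      exact Measure.smul_absolutelyContinuous
    filter_upwards [hq.ae hm_even] with ξ hξ
    rw [symbol, symbol, mul_neg, hξ]
  -- Conjugating the integrand and reflecting `ξ` cancel each other.
  rw [opTFun, Real.fourierInv_eq', ← integral_conj, ← integral_neg_eq_self]
  refine integral_congr_ae ?_
  filter_upwards [hm] with ξ hξ
  rw [smul_eq_mul, smul_eq_mul, map_mul, map_mul, ← Complex.exp_conj, hF, neg_neg, hξ]
  congr 1
  · congr 1
    rw [map_mul, Complex.conj_ofReal, Complex.conj_I]
    simp
  · simp [symbol]

end

end MWhiteNoise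

/-! ### The derivative of the `m`-Brownian motion. -/

theorem theorem7p8 (P : Measure Omega) (hP : IsWhiteNoise P)
    (m : ℝ → ℝ) (hm_meas : Measurable m) (hm_nonneg : ∀ u, 0 ≤ m u)
    (hm_int : Integrable (fun u : ℝ => m u / (u ^ 2 + 1)))
    (K K' b : ℝ) (hK : 0 < K) (hK' : 0 < K') (hb : b < 2)
    (hm_low : ∀ u : ℝ, 0 < |u| → |u| ≤ 1 → m u ≤ K * |u| ^ (-b))
    (hm_high : ∀ u : ℝ, 1 < |u| → m u ≤ K') :
    -- all objects are well defined
    (∀ t, MemDom m (indicatorI t)) ∧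
    (∀ k, MemDom m ((hermiteFunC k).toLp 2) ∧
      Continuous (opTFun m (hermiteFunC k)) ∧
      opT m ((hermiteFunC k).toLp 2) =ᵐ[volume] opTFun m (hermiteFunC k)) ∧
    -- the derivative of the `m`-Brownian motion
    (HasKondratievDeriv (fun t => chaosExpansion (mBrownian hP m t)) (mWhiteNoiseConj m) ∧
      ∀ δ : ℝ, 0 < δ → HasHermiteDerivBoundedly 4 δ
        (fun t => chaosExpansion (mBrownian hP m t)) (mWhiteNoiseConj m)) ∧
    -- for even `m`, it is the `m`-white noise `W_m`
    ((∀ᵐ u : ℝ, m (-u) = m u) →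
      HasKondratievDeriv (fun t => chaosExpansion (mBrownian hP m t)) (mWhiteNoise m) ∧
      ∀ δ : ℝ, 0 < δ → HasHermiteDerivBoundedly 4 δ
        (fun t => chaosExpansion (mBrownian hP m t)) (mWhiteNoise m)) := by
  have hW : HasKondratievDeriv (fun t => chaosExpansion (mBrownian hP m t)) (mWhiteNoiseConj m) ∧
      ∀ δ : ℝ, 0 < δ → HasHermiteDerivBoundedly 4 δ
        (fun t => chaosExpansion (mBrownian hP m t)) (mWhiteNoiseConj m) := by
    -- Continuity of `T_m h̃_k` gives the derivative at every `t`, not just almost everywhere.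
    have hc : ∀ t k, HasDerivAt
        (fun s => ∫ x in (0 : ℝ)..s, conj (opTFun m (hermiteFunC k) x))
        (conj (opTFun m (hermiteFunC k) t)) t := fun t k =>
      ((Complex.continuous_conj.comp (continuous_opTFun hm_meas hm_nonneg hm_int
        (hermiteFunC k))).integral_hasStrictDerivAt 0 t).hasDerivAt
    have hd : ∀ t k, ‖conj (opTFun m (hermiteFunC k) t)‖ ≤
        ((∫ ξ : ℝ, m (2 * Real.pi * ξ) / ((2 * Real.pi * ξ) ^ 2 + 1)) + 2) * ((k : ℝ) + 1) :=
      fun t k => by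
        rw [RCLike.norm_conj]
        exact norm_opTFun_hermiteFunC_le hm_meas hm_nonneg hm_int k t
    simp_rw [chaosExpansion_mBrownian hP hm_meas hm_nonneg hm_int]
    -- The coefficients vanish at `t = 0`, so the bound on their derivatives also bounds the
    -- coefficients themselves.
    exact ⟨hasKondratievDeriv_firstChaos hc hd fun k => intervalIntegral.integral_same,
      fun δ _ => hasHermiteDerivBoundedly_firstChaos hc hd
        (fun k => intervalIntegral.integral_same) δ⟩
  refine ⟨memDom_indicatorI hm_meas hm_nonneg hm_int, fun k =>
    ⟨memDom_schwartz hm_meas hm_nonneg hm_int _, continuous_opTFun hm_meas hm_nonneg hm_int _,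
      opT_schwartz_ae_eq hm_meas hm_nonneg hm_int _⟩, hW, fun hm_even => ?_⟩
  have hconj : mWhiteNoiseConj m = mWhiteNoise m := by
    funext t
    simp_rw [mWhiteNoiseConj, mWhiteNoise, conj_opTFun_hermiteFunC hm_even]
  rwa [hconj] at hW
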